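/- Let $u<v$ be real numbers, $r_0:=v-u$, and let $S=S_{u,v}$ be the $2$-sphere with unit round metric $\mathring\gamma$ and $\gamma:=r_0^2\mathring\gamma$. **Sphere data.** Sphere data on $S$ is a tuple $$x=(\Omega,g,\Omega\mathrm{tr}\chi,\hat\chi,\Omega\mathrm{tr}\underline\chi,\underline{\hat\chi},\eta,\omega,D\omega,\underline\omega,\underline D\underline\omega,\alpha,\underline\alpha)$$ where $\Omega>0$ is a function, $g$ a Riemannian metric, $\Omega\mathrm{tr}\chi,\Omega\mathrm{tr}\underline\chi,\omega,D\omega,\underline\omega,\underline D\underline\omega$ are functions (independent entries of the tuple), $\eta$ is a $1$-form and $\hat\chi,\underline{\hat\chi},\alpha,\underline\alpha$ are symmetric $g$-tracefree $2$-tensors. Tensors in $H^m$, $m\ge2$, are represented by their continuous representatives. For a tensor $T$ put $\|T\|_{H^m}^2:=\sum_{i=0}^m\|\nabla^iT\|_{L^2}^2$ with covariant derivative, lengths and measure of $\gamma$, and let $$\|x\|_{\mathcal X}:=\|(\Omega,g,\Omega\mathrm{tr}\chi,\hat\chi,\omega,D\omega,\alpha)\|_{H^6}+\|\eta\|_{H^5}+\|(\Omega\mathrm{tr}\underline\chi,\underline{\hat\chi},\underline\omega)\|_{H^4}+\|(\underline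 D\underline\omega,\underline\alpha)\|_{H^2},$$ where the norm of a list is the sum of the norms of its entries. Let $\mathfrak m:=(1,r_0^2\mathring\gamma,\tfrac2{r_0},0,-\tfrac2{r_0},0,0,0,0,0,0,0,0)$ be the Minkowski data; $x-\mathfrak m$ is the componentwise difference. **Modes.** Let $Y^{(0)}=(4\pi)^{-1/2}$ and $Y^{(1m)}$, $m=-1,0,1$, be the standard real spherical harmonics of degree $0$ and $1$, and $E^{(1m)}:=-\tfrac1{\sqrt2}dY^{(1m)}$, $H^{(1m)}:=\tfrac1{\sqrt2}{}^*dY^{(1m)}$, with ${}^*$ the Hodge dual of $\mathring\gamma$. For a function $f$ and a $1$-form $X$, the coefficients $f^{(0)},f^{(1m)},X_E^{(1m)},X_H^{(1m)}$ are the $L^2(\mathring\gamma)$ products with these; $f^{[\le1]}:=f^{(0)}Y^{(0)}+\sum_mf^{(1m)}Y^{(1m)}$, $f^{[\ge2]}:=f-f^{[\le1]}$, $X^{[1]}:=\sum_m(X_E^{(1m)}E^{(1m)}+X_H^{(1m)}H^{(1m)})$, $X^{[\ge2]}:=X-X^{[1]}$. **Charges.** Let $\mathrm{tr}\chi:=\Omega^{-1}(\Omega\mathrm{tr}\chi)$,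 $\mathrm{tr}\underline\chi:=\Omega^{-1}(\Omega\mathrm{tr}\underline\chi)$, $\zeta:=\eta-d\log\Omega$, and define $\rho,\beta$ by $$-\rho=K+\tfrac14\mathrm{tr}\chi\,\mathrm{tr}\underline\chi-\tfrac12(\hat\chi,\underline{\hat\chi}),\qquad-\beta=\mathrm{div}\,\hat\chi-\tfrac12d\,\mathrm{tr}\chi+\hat\chi\cdot\zeta-\tfrac12\mathrm{tr}\chi\,\zeta,$$ with Gauss curvature $K$, divergence and contractions of $g$. Let $r$ be the area radius, $4\pi r^2=\mathrm{area}_g(S)$, and for $m=-1,0,1$ $$\mathbf E=-\tfrac{\sqrt{4\pi}}{8\pi}\big(r^3(\rho+r\,\mathrm{div}\,\beta)\big)^{(0)},\qquad\mathbf P^m=-\tfrac1{8\pi}\sqrt{\tfrac{4\pi}3}\big(r^3(\rho+r\,\mathrm{div}\,\beta)\big)^{(1m)},$$ $$\mathbf L^m=\tfrac1{16\pi}\sqrt{\tfrac{8\pi}3}\,\Xi_H^{(1m)},\qquad\mathbf G^m=\tfrac1{16\pi}\sqrt{\tfrac{8\pi}3}\,\Xi_E^{(1m)},\qquad\Xi:=r^3\big(d\,\mathrm{tr}\chi+\mathrm{tr}\chi(\eta-d\log\Omega)\big).$$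 **Matching map.** Let $\phi>0$ be given by $\phi^2:=d\mu_g/d\mu_{\mathring\gamma}$ and $g_c:=\phi^{-2}g$. With $\mathring{\mathrm{div}}$, $\mathring\Delta$ the divergence and Laplace-Beltrami operator of $\mathring\gamma$, and $F:=(\Omega\mathrm{tr}\chi-\tfrac4{r_0}\Omega)^{[\le1]}$, let $$\tilde{\mathcal Q}_5:=\underline\omega^{[\le1]}+\tfrac14(\Omega\mathrm{tr}\underline\chi)^{[\le1]}-\tfrac1{6r_0}\mathring{\mathrm{div}}\,\eta^{[1]}-\tfrac1{12r_0^3}(\mathring\Delta+3)F-\tfrac1{2r_0^2}(\mathring\Delta+2)\phi^{[\le1]},$$ $$\tilde{\mathcal Q}_6:=(\underline D\underline\omega)^{[\le1]}-\tfrac16(\mathring\Delta-3)\big(\tfrac1{r_0}\Omega\mathrm{tr}\underline\chi-\tfrac2{r_0^3}(\mathring\Delta+2)\phi\big)^{[\le1]}+\tfrac1{6r_0}(\mathring\Delta\mathring\Delta+\mathring\Delta-3)F-\tfrac2{3r_0^2}\mathring{\mathrm{div}}\,\eta^{[1]},$$ $$\mathfrak M(x):=\big(\Omega,\phi,g_c,\Omega\mathrm{tr}\chi,\hat\chi,(\Omega\mathrm{tr}\underline\chi)^{[\ge2]},\underline{\hat\chi},\eta^{[\ge2]},\omega,D\omega,\underline\omega^{[\ge2]},(\underline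 D\underline\omega)^{[\ge2]},\tilde{\mathcal Q}_5,\tilde{\mathcal Q}_6,\alpha,\underline\alpha\big).$$ **Lemma.** There is $\varepsilon_0>0$, depending only on $u$ and $v$, such that for all $0<\varepsilon\le\varepsilon_0$ the following holds. Let $x,x'$ be sphere data on $S_{u,v}$ with $$\|x-\mathfrak m\|_{\mathcal X}+\|x'-\mathfrak m\|_{\mathcal X}\le\varepsilon,\qquad\mathfrak M(x)=\mathfrak M(x').$$ If in addition $(\mathbf E,\mathbf P,\mathbf L,\mathbf G)(x)=(\mathbf E,\mathbf P,\mathbf L,\mathbf G)(x')$, then $x=x'$. -/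

import Mathlib

open MeasureTheory Filter Topology
open scoped ENNReal

noncomputable section

namespace CharGluing

/-! ### The round unit sphere and tensor calculus on it

Covariant tensors of rank `k` on the unit sphere of Euclidean 3-space are written in Cartesian
components: a rank `k` tensor at `p` is a function of `k` indices in `Fin 3` that is annihilated by
contraction of any index with the unit normal `p`. -/

abbrev E3 : Type := EuclideanSpace ℝ (Fin 3)

/-- The unit sphere. -/
abbrev S2 : Type := Metric.sphere (0 : E3) 1

/-- The area measure of the round unit metric (of total mass `4π`). -/
abbrev area : Measure S2 := (volume : Measure E3).toSphere

/-- Fields of rank `k` tensors, in Cartesian components. -/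
abbrev TensorField (k : ℕ) : Type := S2 → (Fin k → Fin 3) → ℝ

/-- Tangency to the sphere: every contraction with the normal vanishes. -/
def Tangential {k : ℕ} (T : TensorField k) : Prop :=
  ∀ (p : S2) (I : Fin k → Fin 3) (s : Fin k), ∑ a, p.1 a * T p (Function.update I s a) = 0

/-- Scalar functions as tensors of rank `0`. -/
def scalar (f : S2 → ℝ) : TensorField 0 := fun p _ => f p

/-- Radial projection to the sphere (the value at the origin is irrelevant). -/
def radial (x : E3) : S2 :=
  if h : x ≠ 0 then ⟨‖x‖⁻¹ • x, by simp [norm_smul, h]⟩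
  else ⟨EuclideanSpace.single 2 1, by simp⟩

/-- The `j`-th Cartesian partial derivative, at a point of the sphere, of the extension of `f` that
is constant along rays; it is the `j`-th Cartesian component of the tangential gradient. -/
def pd (j : Fin 3) (f : S2 → ℝ) (p : S2) : ℝ :=
  fderiv ℝ (fun x : E3 => f (radial x)) p.1 (EuclideanSpace.single j 1)

/-- The orthogonal projection to the tangent plane, which is also the round unit metric. -/
def proj (p : S2) (a b : Fin 3) : ℝ := (if a = b then 1 else 0) - p.1 a * p.1 b

/-- The round unit metric as a tensor field. -/
def roundMetric : TensorField 2 := fun p I => proj p (I 0) (I 1)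

/-- The exterior derivative of a scalar function. -/
def dS (f : S2 → ℝ) : TensorField 1 := fun p I => pd (I 0) f p

/-- The Levi-Civita covariant derivative of the round metric: the tangential projection of the
derivative in Euclidean space. The differentiation index comes first. -/
def covD {k : ℕ} (T : TensorField k) : TensorField (k + 1) := fun p J =>
  ∑ I : Fin (k + 1) → Fin 3, (∏ s, proj p (J s) (I s)) * pd (I 0) (fun q => T q (Fin.tail I)) p

/-- Iterated covariant derivatives of the round metric. -/
def covDIter {k : ℕ} : (i : ℕ) → TensorField k → TensorField (k + i)
  | 0, T => T
  | i + 1, T => covD (covDIter i T)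

/-- The divergence of a 1-form with respect to the round unit metric. -/
def divRound (X : TensorField 1) : S2 → ℝ := fun p => ∑ a, covD X p ![a, a]

/-- The Laplace-Beltrami operator of the round unit metric. -/
def lapRound (f : S2 → ℝ) : S2 → ℝ := divRound (dS f)

/-- The area form of the round unit metric, with the orientation of the outward normal. -/
def areaForm (p : S2) (a b : Fin 3) : ℝ :=
  Matrix.det (Matrix.of ![fun i => p.1 i, Pi.single a 1, Pi.single b 1])

/-- The Hodge dual of a 1-form with respect to the round metric. -/
def hodge (X : TensorField 1) : TensorField 1 := fun p I => ∑ b, areaForm p (I 0) b * X p ![b]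

/-! ### Sobolev norms -/

/-- Smooth tensor fields on the sphere. -/
def SmoothField {k : ℕ} (T : TensorField k) : Prop :=
  Tangential T ∧ ContDiffOn ℝ ((⊤ : ℕ∞) : WithTop ℕ∞) (fun x : E3 => T (radial x)) {0}ᶜ

/-- The square of the `L²` norm with respect to the round unit metric. -/
def L2sq {k : ℕ} (T : TensorField k) : ℝ≥0∞ := ∫⁻ p, ENNReal.ofReal (∑ I, T p I ^ 2) ∂area

/-- `D i` is the `i`-th covariant derivative, in the sense of `L²`, of the tensor field `T`, for all
`i ≤ m`: there are smooth tensor fields which approximate `T` in `L²` and whose covariant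
derivatives of order `i ≤ m` converge to `D i` in `L²`. (On the sphere this is the same as being
the weak covariant derivatives of `T` and lying in `L²`.) -/
def IsSobolevDeriv {k : ℕ} (m : ℕ) (T : TensorField k) (D : (i : ℕ) → TensorField (k + i)) : Prop :=
  D 0 = T ∧ (∀ i ≤ m, Measurable (D i)) ∧
    ∃ Φ : ℕ → TensorField k, (∀ n, SmoothField (Φ n)) ∧
      ∀ i ≤ m, Tendsto (fun n => L2sq (covDIter i (Φ n) - D i)) atTop (𝓝 0)

/-- The `H^m` norm with respect to the round metric `γ = r² γ₀`, where `γ₀` is the unit one: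
the root of the sum over `0 ≤ i ≤ m` of the squared `L²` norms of the `i`-th covariant derivatives.
The square of the `γ`-length of a covariant tensor of rank `k + i` carries the factor
`r ^ (-2 (k + i))` and the area element of `γ` the factor `r ^ 2`. The value is `∞` for fields that
are not in `H^m`; for the others the infimum is over one family of derivatives, up to null sets. -/
def sobolevNorm (r : ℝ) (m : ℕ) {k : ℕ} (T : TensorField k) : ℝ≥0∞ :=
  ⨅ (D : (i : ℕ) → TensorField (k + i)) (_ : IsSobolevDeriv m T D),
    (∑ i ∈ Finset.range (m + 1),
      ENNReal.ofReal (r ^ ((2 : ℤ) - 2 * ((k : ℤ) + (i : ℤ)))) * L2sq (D i)) ^ (1 / 2 : ℝ)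

/-! ### Spherical harmonics of degree at most one -/

/-- The spherical harmonic of degree `0`. -/
def Y0 : S2 → ℝ := fun _ => 1 / √(4 * Real.pi)

/-- The real spherical harmonics of degree `1`; the indices `0, 1, 2` stand for the orders
`-1, 0, 1`, which belong to the Cartesian coordinates `y, z, x`. -/
def Y1 (m : Fin 3) : S2 → ℝ := fun p => √(3 / (4 * Real.pi)) * p.1 ((![1, 2, 0] : Fin 3 → Fin 3) m)

/-- The electric vector spherical harmonics of degree `1`. -/
def E1 (m : Fin 3) : TensorField 1 := (1 / √2) • (-dS (Y1 m))

/-- The magnetic vector spherical harmonics of degree `1`. -/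
def H1 (m : Fin 3) : TensorField 1 := (1 / √2) • hodge (dS (Y1 m))

/-- The coefficient of `f` with respect to the harmonic `Y`. -/
def coeff (f Y : S2 → ℝ) : ℝ := ∫ p, f p * Y p ∂area

/-- The coefficient of the 1-form `X` with respect to the vector harmonic `Z`. -/
def vcoeff (X Z : TensorField 1) : ℝ := ∫ p, (∑ a, X p ![a] * Z p ![a]) ∂area

/-- The part of a function in the modes `l ≤ 1`. -/
def low (f : S2 → ℝ) : S2 → ℝ := coeff f Y0 • Y0 + ∑ m, coeff f (Y1 m) • Y1 m

/-- The part of a function in the modes `l ≥ 2`: what remains after subtracting the `L²` orthogonal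
projection to the modes `l ≤ 1`. -/
def high (f : S2 → ℝ) : S2 → ℝ := f - low f

/-- The part of a 1-form in the modes `l = 1`. -/
def vlow (X : TensorField 1) : TensorField 1 :=
  ∑ m, (vcoeff X (E1 m) • E1 m + vcoeff X (H1 m) • H1 m)

/-- The part of a 1-form in the modes `l ≥ 2`: what remains after subtracting the `L²` orthogonal
projection to the modes `l = 1` (there are no vector harmonics with `l = 0`). -/
def vhigh (X : TensorField 1) : TensorField 1 := X - vlow X

/-! ### Geometry of a Riemannian metric on the sphere -/

/-- The metric `g`, completed by the square of the unit conormal to a form on Euclidean space. -/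
def fullMatrix (g : TensorField 2) (p : S2) : Matrix (Fin 3) (Fin 3) ℝ :=
  Matrix.of fun a b => g p ![a, b] + p.1 a * p.1 b

/-- The inverse metric. -/
def ginv (g : TensorField 2) (p : S2) (a b : Fin 3) : ℝ := (fullMatrix g p)⁻¹ a b - p.1 a * p.1 b

/-- The density of the area element of `g` with respect to the area element of the round unit
metric. -/
def areaDensity (g : TensorField 2) (p : S2) : ℝ := √(fullMatrix g p).det

/-- The area radius of the metric `g`: `4 π r² = area_g(S)`. -/
def areaRadius (g : TensorField 2) : ℝ := √((∫ p, areaDensity g p ∂area) / (4 * Real.pi))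

/-- The conformal factor `φ > 0`, where `φ²` is the quotient of the area densities. -/
def confFactor (g : TensorField 2) : S2 → ℝ := fun p => √(areaDensity g p)

/-- The metric `φ⁻² g`, which has the area element of the round unit metric. -/
def confMetric (g : TensorField 2) : TensorField 2 := fun p I => (confFactor g p ^ 2)⁻¹ * g p I

/-- The Christoffel tensor: the difference of the Levi-Civita connections of `g` and of the round
metric, `C^c_{ab} = ½ g^{cd} (∇_a g_{bd} + ∇_b g_{ad} - ∇_d g_{ab})` with the round covariant
derivative `∇`. The upper index comes first. -/
def christoffel (g : TensorField 2) : TensorField 3 := fun p I =>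
  (1 / 2) * ∑ d, ginv g p (I 0) d *
    (covD g p ![I 1, I 2, d] + covD g p ![I 2, I 1, d] - covD g p ![d, I 1, I 2])

/-- The Levi-Civita covariant derivative of the metric `g`. -/
def covDg (g : TensorField 2) {k : ℕ} (T : TensorField k) : TensorField (k + 1) := fun p J =>
  covD T p J -
    ∑ s : Fin k, ∑ c, christoffel g p ![c, J 0, J s.succ] * T p (Function.update (Fin.tail J) s c)

/-- The Ricci tensor of `g`: the Ricci tensor of the round unit metric, which is that metric itself,
plus `∇_c C^c_{ab} - ∇_a C^c_{cb} + C^c_{ce} C^e_{ab} - C^c_{ae} C^e_{cb}`. -/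
def ricci (g : TensorField 2) (p : S2) (a b : Fin 3) : ℝ :=
  proj p a b
    + ∑ c, covD (christoffel g) p ![c, c, a, b]
    - ∑ c, covD (christoffel g) p ![a, c, c, b]
    + ∑ c, ∑ e, christoffel g p ![c, c, e] * christoffel g p ![e, a, b]
    - ∑ c, ∑ e, christoffel g p ![c, a, e] * christoffel g p ![e, c, b]

/-- The Gauss curvature of `g`, half of its scalar curvature. -/
def gaussCurvature (g : TensorField 2) : S2 → ℝ := fun p =>
  (1 / 2) * ∑ a, ∑ b, ginv g p a b * ricci g p a b

/-- The divergence `∇^a X_a` with respect to `g`. -/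
def divg (g : TensorField 2) (X : TensorField 1) : S2 → ℝ := fun p =>
  ∑ a, ∑ b, ginv g p a b * covDg g X p ![a, b]

/-- The divergence `∇^b V_{ba}` with respect to `g`. -/
def divg2 (g : TensorField 2) (V : TensorField 2) : TensorField 1 := fun p I =>
  ∑ b, ∑ c, ginv g p b c * covDg g V p ![c, b, I 0]

/-- The scalar product of 2-tensors with respect to `g`. -/
def innerg (g : TensorField 2) (V W : TensorField 2) : S2 → ℝ := fun p =>
  ∑ a, ∑ b, ∑ c, ∑ d, ginv g p a c * ginv g p b d * V p ![a, b] * W p ![c, d]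

/-- The contraction `V_{ab} X^b` with respect to `g`. -/
def contractg (g : TensorField 2) (V : TensorField 2) (X : TensorField 1) : TensorField 1 := fun p I =>
  ∑ b, ∑ c, V p ![I 0, b] * ginv g p b c * X p ![c]

/-! ### Sphere data -/

/-- A tuple of tensor fields
`(Ω, g, Ω trχ, χ̂, Ω trχ_, χ̂_, η, ω, Dω, ω_, D_ω_, α, α_)`; the suffix `bar` stands for the
underline. The fields `Dω` and `DbarOmegaBar` are independent entries of the tuple. -/
@[ext]
structure SphereTuple where
  Ω : S2 → ℝ
  g : TensorField 2
  Ωtrχ : S2 → ℝ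
  χhat : TensorField 2
  Ωtrχbar : S2 → ℝ
  χhatbar : TensorField 2
  η : TensorField 1
  ω : S2 → ℝ
  Dω : S2 → ℝ
  ωbar : S2 → ℝ
  DbarOmegaBar : S2 → ℝ
  α : TensorField 2
  αbar : TensorField 2

/-- The componentwise difference of tuples. -/
instance : Sub SphereTuple where
  sub x y :=
    { Ω := x.Ω - y.Ω
      g := x.g - y.g
      Ωtrχ := x.Ωtrχ - y.Ωtrχ
      χhat := x.χhat - y.χhat
      Ωtrχbar := x.Ωtrχbar - y.Ωtrχbar
      χhatbar := x.χhatbar - y.χhatbar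
      η := x.η - y.η
      ω := x.ω - y.ω
      Dω := x.Dω - y.Dω
      ωbar := x.ωbar - y.ωbar
      DbarOmegaBar := x.DbarOmegaBar - y.DbarOmegaBar
      α := x.α - y.α
      αbar := x.αbar - y.αbar }

/-- A continuous Riemannian metric on the sphere. -/
structure IsMetric (g : TensorField 2) : Prop where
  cont : Continuous g
  tang : Tangential g
  symm : ∀ p a b, g p ![a, b] = g p ![b, a]
  pos : ∀ (p : S2) (w : Fin 3 → ℝ), w ≠ 0 → ∑ a, p.1 a * w a = 0 →
    0 < ∑ a, ∑ b, g p ![a, b] * w a * w b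

/-- A continuous symmetric `g`-tracefree 2-tensor. -/
structure IsSymTracefree (g V : TensorField 2) : Prop where
  cont : Continuous V
  tang : Tangential V
  symm : ∀ p a b, V p ![a, b] = V p ![b, a]
  tracefree : ∀ p, ∑ a, ∑ b, ginv g p a b * V p ![a, b] = 0

/-- Sphere data. All components of sphere data of finite norm lie in `H²` of the sphere or better,
and are represented by their continuous representatives. -/
structure IsSphereData (x : SphereTuple) : Prop where
  Ω_cont : Continuous x.Ω
  Ω_pos : ∀ p, 0 < x.Ω p
  g_metric : IsMetric x.g
  Ωtrχ_cont : Continuous x.Ωtrχ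
  χhat_stf : IsSymTracefree x.g x.χhat
  Ωtrχbar_cont : Continuous x.Ωtrχbar
  χhatbar_stf : IsSymTracefree x.g x.χhatbar
  η_cont : Continuous x.η
  η_tang : Tangential x.η
  ω_cont : Continuous x.ω
  Dω_cont : Continuous x.Dω
  ωbar_cont : Continuous x.ωbar
  DbarOmegaBar_cont : Continuous x.DbarOmegaBar
  α_stf : IsSymTracefree x.g x.α
  αbar_stf : IsSymTracefree x.g x.αbar

/-- The reference Minkowski sphere data on the sphere with parameters `u < v`. -/
def minkowski (u v : ℝ) : SphereTuple where
  Ω := fun _ => 1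
  g := (v - u) ^ 2 • roundMetric
  Ωtrχ := fun _ => 2 / (v - u)
  χhat := 0
  Ωtrχbar := fun _ => -(2 / (v - u))
  χhatbar := 0
  η := 0
  ω := 0
  Dω := 0
  ωbar := 0
  DbarOmegaBar := 0
  α := 0
  αbar := 0

/-- The norm for sphere data (`∞` for tuples that are not of the required regularity). -/
def normX (u v : ℝ) (x : SphereTuple) : ℝ≥0∞ :=
  sobolevNorm (v - u) 6 (scalar x.Ω) + sobolevNorm (v - u) 6 x.g
    + sobolevNorm (v - u) 6 (scalar x.Ωtrχ) + sobolevNorm (v - u) 6 x.χhat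
    + sobolevNorm (v - u) 4 (scalar x.Ωtrχbar) + sobolevNorm (v - u) 4 x.χhatbar
    + sobolevNorm (v - u) 5 x.η
    + sobolevNorm (v - u) 6 (scalar x.ω) + sobolevNorm (v - u) 6 (scalar x.Dω)
    + sobolevNorm (v - u) 4 (scalar x.ωbar) + sobolevNorm (v - u) 2 (scalar x.DbarOmegaBar)
    + sobolevNorm (v - u) 6 x.α + sobolevNorm (v - u) 2 x.αbar

/-! ### Charges -/

/-- The null expansion `trχ`. -/
def trχ (x : SphereTuple) : S2 → ℝ := fun p => x.Ωtrχ p / x.Ω p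

/-- The ingoing null expansion. -/
def trχbar (x : SphereTuple) : S2 → ℝ := fun p => x.Ωtrχbar p / x.Ω p

/-- The torsion `ζ = η - d log Ω`. -/
def ζ (x : SphereTuple) : TensorField 1 := x.η - dS (fun p => Real.log (x.Ω p))

/-- The curvature component `ρ`, by the Gauss equation
`K + ¼ trχ trχ_ - ½ (χ̂, χ̂_) = -ρ`. -/
def ρ (x : SphereTuple) : S2 → ℝ := fun p =>
  -(gaussCurvature x.g p + (1 / 4) * trχ x p * trχbar x p
    - (1 / 2) * innerg x.g x.χhat x.χhatbar p)

/-- The curvature component `β`, by the Gauss-Codazzi equation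
`div χ̂ - ½ d trχ + χ̂ · ζ - ½ trχ ζ = -β`. -/
def β (x : SphereTuple) : TensorField 1 := fun p I =>
  -(divg2 x.g x.χhat p I - (1 / 2) * dS (trχ x) p I
    + contractg x.g x.χhat (ζ x) p I - (1 / 2) * trχ x p * ζ x p I)

/-- The function `r³ (ρ + r div β)`, with the area radius `r`. -/
def chargeScalar (x : SphereTuple) : S2 → ℝ := fun p =>
  areaRadius x.g ^ 3 * (ρ x p + areaRadius x.g * divg x.g (β x) p)

/-- The 1-form `r³ (d trχ + trχ (η - d log Ω))`, with the area radius `r`. -/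
def chargeForm (x : SphereTuple) : TensorField 1 := fun p I =>
  areaRadius x.g ^ 3 *
    (dS (trχ x) p I + trχ x p * (x.η p I - dS (fun q => Real.log (x.Ω q)) p I))

/-- The charges `(E, P, L, G)`. The indices `0, 1, 2` stand for `m = -1, 0, 1`. -/
@[ext]
structure Charges where
  E : ℝ
  P : Fin 3 → ℝ
  L : Fin 3 → ℝ
  G : Fin 3 → ℝ

def charges (x : SphereTuple) : Charges where
  E := -(1 / (8 * Real.pi)) * √(4 * Real.pi) * coeff (chargeScalar x) Y0
  P := fun m => -(1 / (8 * Real.pi)) * √(4 * Real.pi / 3) * coeff (chargeScalar x) (Y1 m)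
  L := fun m => 1 / (16 * Real.pi) * √(8 * Real.pi / 3) * vcoeff (chargeForm x) (H1 m)
  G := fun m => 1 / (16 * Real.pi) * √(8 * Real.pi / 3) * vcoeff (chargeForm x) (E1 m)

/-! ### The matching map -/

/-- The quantity `Q̃₅`, with `r = v - u`. -/
def Q5 (u v : ℝ) (x : SphereTuple) : S2 → ℝ :=
  let r := v - u
  let F := low (x.Ωtrχ - (4 / r) • x.Ω)
  low x.ωbar + (1 / 4 : ℝ) • low x.Ωtrχbar - (1 / (6 * r)) • divRound (vlow x.η)
    - (1 / (12 * r ^ 3)) • (lapRound F + (3 : ℝ) • F)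
    - (1 / (2 * r ^ 2)) •
      (lapRound (low (confFactor x.g)) + (2 : ℝ) • low (confFactor x.g))

/-- The quantity `Q̃₆`, with `r = v - u`. -/
def Q6 (u v : ℝ) (x : SphereTuple) : S2 → ℝ :=
  let r := v - u
  let F := low (x.Ωtrχ - (4 / r) • x.Ω)
  let N := low ((1 / r) • x.Ωtrχbar
    - (2 / r ^ 3) • (lapRound (confFactor x.g) + (2 : ℝ) • confFactor x.g))
  low x.DbarOmegaBar - (1 / 6 : ℝ) • (lapRound N - (3 : ℝ) • N)
    + (1 / (6 * r)) • (lapRound (lapRound F) + lapRound F - (3 : ℝ) • F)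
    - (2 / (3 * r ^ 2)) • divRound (vlow x.η)

/-- Matching data. -/
@[ext]
structure MatchingData where
  Ω : S2 → ℝ
  φ : S2 → ℝ
  gc : TensorField 2
  Ωtrχ : S2 → ℝ
  χhat : TensorField 2
  Ωtrχbar_high : S2 → ℝ
  χhatbar : TensorField 2
  η_high : TensorField 1
  ω : S2 → ℝ
  Dω : S2 → ℝ
  ωbar_high : S2 → ℝ
  DbarOmegaBar_high : S2 → ℝ
  Q5 : S2 → ℝ
  Q6 : S2 → ℝ
  α : TensorField 2
  αbar : TensorField 2

/-- The matching map. -/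
def matching (u v : ℝ) (x : SphereTuple) : MatchingData where
  Ω := x.Ω
  φ := confFactor x.g
  gc := confMetric x.g
  Ωtrχ := x.Ωtrχ
  χhat := x.χhat
  Ωtrχbar_high := high x.Ωtrχbar
  χhatbar := x.χhatbar
  η_high := vhigh x.η
  ω := x.ω
  Dω := x.Dω
  ωbar_high := high x.ωbar
  DbarOmegaBar_high := high x.DbarOmegaBar
  Q5 := Q5 u v x
  Q6 := Q6 u v x
  α := x.α
  αbar := x.αbar

end CharGluing

end

/-! The matching data fix everything in `x` except the modes `l ≤ 1` of `Ωtrχbar`, `ωbar`,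
`DbarOmegaBar` and the mode `l = 1` of `η`; in particular `g = φ² g_c` is fixed. The charges supply
the rest, without any linearisation.

The form in the charges `L`, `G` depends on `η` only through `r³ trχ η`. Equal charges therefore say
that `trχ (η - η')` is `L²`-orthogonal to all `E1 m` and `H1 m`, while `η - η'` itself lies in their
span because the parts `l ≥ 2` agree. Testing `η - η'` against itself gives `∫ trχ |η - η'|² = 0`,
so `η = η'` as soon as `trχ > 0`. Now `ζ` and `β` agree, and `r³ (ρ + r div β)` differs only by `-¼
r³ (trχ / Ω)` times the difference of `Ωtrχbar`. The same argument with the positive weight `trχ /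
Ω` and the charges `E`, `P` settles `Ωtrχbar`. Finally `Q5` and `Q6` reduce to the low modes of
`ωbar` and `DbarOmegaBar`. This is `eq_of_matching_of_charges`, resting on
`sum_mul_eq_zero_of_integral`.

The analytic input is a Sobolev embedding on the sphere, used twice: smallness in `H⁶` makes `Ωtrχ`
pointwise close to `2 / (v - u)`, hence positive (`exists_forall_Ωtrχ_pos`), and finite norm makes
the charge densities continuous (`IsSphereData.isRegularData`), so that the integrals may be
subtracted. The embedding comes from Euclidean space: a function on the sphere is extended along
rays, cut off in the unit ball and bounded by the `L¹` norm of `∂₀∂₁∂₂` (`exists_enorm_sq_le_sob`).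
The identity `covD_eq` converts Cartesian into covariant derivatives. -/

noncomputable section

namespace CharGluing

/-! ### Functions of class `C^n` on the sphere and their tangential derivatives -/

/-- Functions on the sphere whose extension constant along rays is of class `C^n`. -/
def IsCn (n : WithTop ℕ∞) (f : S2 → ℝ) : Prop :=
  ContDiffOn ℝ n (fun x : E3 => f (radial x)) {0}ᶜ

theorem radial_apply {x : E3} (hx : x ≠ 0) : (radial x : E3) = ‖x‖⁻¹ • x := by
  simp [radial, hx]

theorem norm_coe (p : S2) : ‖(p : E3)‖ = 1 := by simp

theorem coe_ne_zero (p : S2) : (p : E3) ≠ 0 := by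
  intro h
  have := norm_coe p
  simp [h] at this

theorem radial_coe (p : S2) : radial (p : E3) = p := by
  apply Subtype.ext
  rw [radial_apply (coe_ne_zero p)]
  simp

theorem radial_smul {c : ℝ} (hc : 0 < c) (x : E3) : radial (c • x) = radial x := by
  by_cases hx : x = 0
  · simp [hx]
  · apply Subtype.ext
    rw [radial_apply hx, radial_apply (smul_ne_zero hc.ne' hx), norm_smul, smul_smul]
    congr 1
    simp only [Real.norm_eq_abs, abs_of_pos hc]
    field_simp

theorem contDiffOn_radial {n : WithTop ℕ∞} :
    ContDiffOn ℝ n (fun x : E3 => (radial x : E3)) {0}ᶜ := by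
  have h : ContDiffOn ℝ n (fun x : E3 => ‖x‖⁻¹ • x) {0}ᶜ := by
    intro x hx
    have hx' : x ≠ 0 := hx
    exact (((contDiffAt_norm ℝ hx').inv (norm_ne_zero_iff.2 hx')).smul
      contDiffAt_id).contDiffWithinAt
  exact h.congr fun x hx => radial_apply hx

theorem continuousOn_radial : ContinuousOn radial ({0}ᶜ : Set E3) := by
  rw [Topology.IsInducing.subtypeVal.continuousOn_iff]
  exact (contDiffOn_radial (n := 0)).continuousOn

theorem isOpen_compl_zero : IsOpen ({0}ᶜ : Set E3) := isOpen_compl_singleton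

theorem IsCn.continuous {n : WithTop ℕ∞} {f : S2 → ℝ} (hf : IsCn n f) : Continuous f := by
  have h := hf.continuousOn.comp_continuous continuous_subtype_val (fun p : S2 => coe_ne_zero p)
  refine h.congr fun p => ?_
  simp only [Function.comp, radial_coe]

theorem isCn_zero_iff {f : S2 → ℝ} : IsCn 0 f ↔ Continuous f := by
  refine ⟨IsCn.continuous, fun h => ?_⟩
  exact contDiffOn_zero.2 (h.comp_continuousOn continuousOn_radial)

theorem IsCn.of_le {m n : WithTop ℕ∞} {f : S2 → ℝ} (hf : IsCn n f) (h : m ≤ n) : IsCn m f :=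
  ContDiffOn.of_le hf h

theorem IsCn.contDiffAt {n : WithTop ℕ∞} {f : S2 → ℝ} (hf : IsCn n f) {x : E3} (hx : x ≠ 0) :
    ContDiffAt ℝ n (fun x : E3 => f (radial x)) x :=
  ContDiffOn.contDiffAt hf (isOpen_compl_zero.mem_nhds hx)

theorem IsCn.differentiableAt {n : WithTop ℕ∞} {f : S2 → ℝ} (hf : IsCn n f) (hn : n ≠ 0)
    {x : E3} (hx : x ≠ 0) : DifferentiableAt ℝ (fun x : E3 => f (radial x)) x :=
  (hf.contDiffAt hx).differentiableAt hn

theorem isCn_const {n : WithTop ℕ∞} (c : ℝ) : IsCn n fun _ => c := contDiffOn_const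

theorem IsCn.add {n : WithTop ℕ∞} {f g : S2 → ℝ} (hf : IsCn n f) (hg : IsCn n g) :
    IsCn n fun p => f p + g p := ContDiffOn.add hf hg

theorem IsCn.sub {n : WithTop ℕ∞} {f g : S2 → ℝ} (hf : IsCn n f) (hg : IsCn n g) :
    IsCn n fun p => f p - g p := ContDiffOn.sub hf hg

theorem IsCn.neg {n : WithTop ℕ∞} {f : S2 → ℝ} (hf : IsCn n f) :
    IsCn n fun p => -f p := ContDiffOn.neg hf

theorem IsCn.mul {n : WithTop ℕ∞} {f g : S2 → ℝ} (hf : IsCn n f) (hg : IsCn n g) :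
    IsCn n fun p => f p * g p := ContDiffOn.mul hf hg

theorem IsCn.inv {n : WithTop ℕ∞} {f : S2 → ℝ} (hf : IsCn n f) (h : ∀ p, f p ≠ 0) :
    IsCn n fun p => (f p)⁻¹ := ContDiffOn.inv hf fun x _ => h (radial x)

theorem IsCn.div {n : WithTop ℕ∞} {f g : S2 → ℝ} (hf : IsCn n f) (hg : IsCn n g)
    (h : ∀ p, g p ≠ 0) : IsCn n fun p => f p / g p := ContDiffOn.div hf hg fun x _ => h (radial x)

theorem IsCn.log {n : WithTop ℕ∞} {f : S2 → ℝ} (hf : IsCn n f) (h : ∀ p, f p ≠ 0) :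
    IsCn n fun p => Real.log (f p) := ContDiffOn.log hf fun x _ => h (radial x)

theorem IsCn.sum {n : WithTop ℕ∞} {ι : Type*} {s : Finset ι} {f : ι → S2 → ℝ}
    (hf : ∀ i ∈ s, IsCn n (f i)) : IsCn n fun p => ∑ i ∈ s, f i p :=
  ContDiffOn.sum fun i hi => hf i hi

theorem IsCn.prod {n : WithTop ℕ∞} {ι : Type*} {s : Finset ι} {f : ι → S2 → ℝ}
    (hf : ∀ i ∈ s, IsCn n (f i)) : IsCn n fun p => ∏ i ∈ s, f i p := by
  classical
  induction s using Finset.induction_on with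
  | empty => simpa using isCn_const 1
  | insert a s ha ih =>
    simp only [Finset.prod_insert ha]
    exact (hf a (by simp)).mul (ih fun i hi => hf i (by simp [hi]))

theorem isCn_coord {n : WithTop ℕ∞} (a : Fin 3) : IsCn n fun p => p.1 a := by
  have h : ContDiff ℝ n fun x : E3 => x a := contDiff_piLp_apply (p := 2)
  exact h.comp_contDiffOn contDiffOn_radial

theorem isCn_proj {n : WithTop ℕ∞} (a b : Fin 3) : IsCn n fun p => proj p a b :=
  (isCn_const _).sub ((isCn_coord a).mul (isCn_coord b))

/-- The differential of the extension constant along rays is homogeneous of degree `-1`. -/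
theorem fderiv_radial_apply {f : S2 → ℝ} {n : WithTop ℕ∞} (hf : IsCn n f) (hn : n ≠ 0) {x : E3}
    (hx : x ≠ 0) (j : Fin 3) :
    fderiv ℝ (fun x : E3 => f (radial x)) x (EuclideanSpace.single j 1)
      = ‖x‖⁻¹ * pd j f (radial x) := by
  have hc : 0 < ‖x‖⁻¹ := inv_pos.2 (norm_pos_iff.2 hx)
  have hy : ‖x‖⁻¹ • x ≠ 0 := smul_ne_zero hc.ne' hx
  -- The extension is invariant under the dilation that carries `x` to the sphere; the chain rule
  -- for this dilation produces the factor `‖x‖⁻¹`.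
  have h1 : (fun y : E3 => f (radial y))
      = (fun y : E3 => f (radial y)) ∘ (fun y : E3 => ‖x‖⁻¹ • y) := by
    funext y
    simp [Function.comp, radial_smul hc]
  have h2 : HasFDerivAt (fun y : E3 => ‖x‖⁻¹ • y) (‖x‖⁻¹ • ContinuousLinearMap.id ℝ E3) x :=
    (ContinuousLinearMap.hasFDerivAt (‖x‖⁻¹ • ContinuousLinearMap.id ℝ E3))
  have h3 := (hf.differentiableAt hn hy).hasFDerivAt.comp x h2
  rw [← h1] at h3
  rw [h3.fderiv, pd, radial_apply hx]
  simp

/-- The extension of `pd j f` along rays is the Euclidean partial derivative composed with `radial`,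
so only one order of differentiability is lost. -/
theorem IsCn.pd {n m : WithTop ℕ∞} {f : S2 → ℝ} (hf : IsCn n f) (hmn : m + 1 ≤ n) (j : Fin 3) :
    IsCn m (pd j f) := by
  have h1 : ContDiffOn ℝ m (fderiv ℝ fun x : E3 => f (radial x)) {0}ᶜ :=
    ContDiffOn.fderiv_of_isOpen hf isOpen_compl_zero hmn
  have h2 : ContDiffOn ℝ m (fun x : E3 => fderiv ℝ (fun x : E3 => f (radial x)) x
      (EuclideanSpace.single j 1)) {0}ᶜ := h1.clm_apply contDiffOn_const
  exact h2.comp contDiffOn_radial fun x _ => coe_ne_zero (radial x)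

theorem pd_add {f g : S2 → ℝ} (hf : IsCn 1 f) (hg : IsCn 1 g) (j : Fin 3) :
    pd j (fun p => f p + g p) = fun p => pd j f p + pd j g p := by
  funext p
  simp only [pd]
  rw [fderiv_fun_add (hf.differentiableAt one_ne_zero (coe_ne_zero p))
    (hg.differentiableAt one_ne_zero (coe_ne_zero p))]
  simp

theorem pd_sub {f g : S2 → ℝ} (hf : IsCn 1 f) (hg : IsCn 1 g) (j : Fin 3) :
    pd j (fun p => f p - g p) = fun p => pd j f p - pd j g p := by
  funext p
  simp only [pd]
  rw [fderiv_fun_sub (hf.differentiableAt one_ne_zero (coe_ne_zero p))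
    (hg.differentiableAt one_ne_zero (coe_ne_zero p))]
  simp

theorem pd_const (c : ℝ) (j : Fin 3) : pd j (fun _ => c) = fun _ => 0 := by
  funext p
  simp [pd]

theorem pd_mul {f g : S2 → ℝ} (hf : IsCn 1 f) (hg : IsCn 1 g) (j : Fin 3) :
    pd j (fun p => f p * g p) = fun p => pd j f p * g p + f p * pd j g p := by
  funext p
  simp only [pd]
  rw [fderiv_fun_mul (hf.differentiableAt one_ne_zero (coe_ne_zero p))
    (hg.differentiableAt one_ne_zero (coe_ne_zero p))]
  simp [radial_coe]
  ring

theorem pd_sum {ι : Type*} {s : Finset ι} {f : ι → S2 → ℝ} (hf : ∀ i ∈ s, IsCn 1 (f i))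
    (j : Fin 3) : pd j (fun p => ∑ i ∈ s, f i p) = fun p => ∑ i ∈ s, pd j (f i) p := by
  funext p
  simp only [pd]
  rw [fderiv_fun_sum fun i hi => (hf i hi).differentiableAt one_ne_zero (coe_ne_zero p)]
  simp

theorem inner_self_coe (p : S2) : ∑ a, p.1 a * p.1 a = 1 := by
  have h := EuclideanSpace.real_norm_sq_eq p.1
  rw [norm_coe] at h
  simp only [← pow_two]
  linarith

/-- The radial derivative of the extension constant along rays vanishes. -/
theorem sum_coord_mul_pd {f : S2 → ℝ} (hf : IsCn 1 f) (p : S2) :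
    ∑ a, p.1 a * pd a f p = 0 := by
  have hd := (hf.differentiableAt one_ne_zero (coe_ne_zero p)).hasFDerivAt
  have h1 : ∑ a, p.1 a * pd a f p = fderiv ℝ (fun x : E3 => f (radial x)) p.1 p.1 := by
    have h := congrArg (fderiv ℝ (fun x : E3 => f (radial x)) p.1)
      ((EuclideanSpace.basisFun (Fin 3) ℝ).sum_repr p.1)
    rw [← h]
    simp only [map_sum, map_smul]
    simp [pd]
  have h2 : HasDerivAt (fun t : ℝ => t • (p.1 : E3)) p.1 1 := by
    simpa using (hasDerivAt_id (1 : ℝ)).smul_const (p.1 : E3)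
  have h3 : HasDerivAt (fun t : ℝ => f (radial (t • (p.1 : E3))))
      (fderiv ℝ (fun x : E3 => f (radial x)) p.1 p.1) 1 := by
    have hd' : HasFDerivAt (fun x : E3 => f (radial x))
      (fderiv ℝ (fun x : E3 => f (radial x)) p.1) ((1 : ℝ) • (p.1 : E3)) := by simpa using hd
    exact hd'.comp_hasDerivAt 1 h2
  -- Along the ray the extension is constant only for `t > 0`, hence the comparison near `t = 1`.
  have h4 : HasDerivAt (fun t : ℝ => f (radial (t • (p.1 : E3)))) 0 1 := by
    refine (hasDerivAt_const (1 : ℝ) (f p)).congr_of_eventuallyEq ?_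
    filter_upwards [eventually_gt_nhds (zero_lt_one (α := ℝ))] with t ht
    rw [radial_smul ht, radial_coe]
  rw [h1, h3.unique h4]

theorem pd_coord (j a : Fin 3) (p : S2) : pd j (fun q => q.1 a) p = proj p j a := by
  have h0 : (p.1 : E3) ≠ 0 := coe_ne_zero p
  have h1 : HasFDerivAt (fun x : E3 => x a) (EuclideanSpace.proj a : E3 →L[ℝ] ℝ) p.1 :=
    (EuclideanSpace.proj a : E3 →L[ℝ] ℝ).hasFDerivAt
  have hn : HasFDerivAt (fun x : E3 => ‖x‖ ^ 2) (2 • (innerSL ℝ (p.1 : E3))) p.1 :=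
    (hasStrictFDerivAt_norm_sq p.1).hasFDerivAt
  have hs : HasFDerivAt (fun x : E3 => ‖x‖) (innerSL ℝ (p.1 : E3)) p.1 := by
    have h := hn.sqrt (by simp)
    simp only [Real.sqrt_sq (norm_nonneg _), norm_coe] at h
    convert! h using 1
    ext v
    simp
  have hi := (hasDerivAt_inv (norm_ne_zero_iff.2 h0)).comp_hasFDerivAt p.1 hs
  have h2 := hi.mul h1
  have h3 : (fun x : E3 => (radial x).1 a) =ᶠ[𝓝 p.1] fun x => ‖x‖⁻¹ * x a := by
    filter_upwards [isOpen_compl_zero.mem_nhds h0] with x hx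
    rw [radial_apply hx]
    simp
  rw [pd, (h2.congr_of_eventuallyEq h3).fderiv]
  simp [proj, Function.comp, EuclideanSpace.inner_single_right]
  by_cases h : j = a <;> simp [h] <;> ring_nf
  simp [Ne.symm h]

/-! ### The pointwise bound of a function by three tangential derivatives -/

/-- Smooth functions on the sphere. -/
abbrev IsSmooth (f : S2 → ℝ) : Prop := IsCn ((⊤ : ℕ∞) : WithTop ℕ∞) f

theorem IsSmooth.isCn {f : S2 → ℝ} (hf : IsSmooth f) (n : ℕ) : IsCn n f :=
  IsCn.of_le hf (by exact_mod_cast le_top)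

theorem IsSmooth.isCn_one {f : S2 → ℝ} (hf : IsSmooth f) : IsCn 1 f := by
  exact_mod_cast hf.isCn 1

theorem IsSmooth.pd {f : S2 → ℝ} (hf : IsSmooth f) (j : Fin 3) : IsSmooth (pd j f) :=
  IsCn.pd hf (by simp) j

/-- The sum of the squared `L²` norms of the tangential derivatives of order at most `m`, in
Cartesian components. -/
def sob : ℕ → (S2 → ℝ) → ℝ≥0∞
  | 0, f => ∫⁻ p, ‖f p‖ₑ ^ 2 ∂area
  | m + 1, f => sob m f + ∑ j, sob m (pd j f)

/-- The `j`-th partial derivative in Euclidean space. -/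
def pderiv (j : Fin 3) (F : E3 → ℝ) (x : E3) : ℝ := fderiv ℝ F x (EuclideanSpace.single j 1)

/-- Iterated partial derivatives; the head of the list is applied first. -/
def pderivs : List (Fin 3) → (E3 → ℝ) → E3 → ℝ
  | [], F => F
  | j :: js, F => pderivs js (pderiv j F)

theorem contDiff_pderiv {F : E3 → ℝ} (hF : ContDiff ℝ ((⊤ : ℕ∞) : WithTop ℕ∞) F) (j : Fin 3) :
    ContDiff ℝ ((⊤ : ℕ∞) : WithTop ℕ∞) (pderiv j F) :=
  (hF.fderiv_right (m := ((⊤ : ℕ∞) : WithTop ℕ∞)) (by simp)).clm_apply contDiff_const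

theorem tsupport_pderiv_subset (F : E3 → ℝ) (j : Fin 3) : tsupport (pderiv j F) ⊆ tsupport F :=
  (closure_mono fun x hx => by
    rw [Function.mem_support] at hx ⊢
    intro h
    exact hx (by simp [pderiv, h])).trans (tsupport_fderiv_subset ℝ)

theorem contDiff_pderivs {F : E3 → ℝ} (hF : ContDiff ℝ ((⊤ : ℕ∞) : WithTop ℕ∞) F)
    (js : List (Fin 3)) : ContDiff ℝ ((⊤ : ℕ∞) : WithTop ℕ∞) (pderivs js F) := by
  induction js generalizing F with
  | nil => exact hF
  | cons j js ih => exact ih (contDiff_pderiv hF j)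

theorem pderiv_add {F G : E3 → ℝ} (hF : ContDiff ℝ ((⊤ : ℕ∞) : WithTop ℕ∞) F)
    (hG : ContDiff ℝ ((⊤ : ℕ∞) : WithTop ℕ∞) G) (j : Fin 3) :
    pderiv j (fun x => F x + G x) = fun x => pderiv j F x + pderiv j G x := by
  funext x
  simp only [pderiv]
  rw [fderiv_fun_add (hF.differentiable (by simp) x) (hG.differentiable (by simp) x)]
  simp

theorem pderivs_add {F G : E3 → ℝ} (hF : ContDiff ℝ ((⊤ : ℕ∞) : WithTop ℕ∞) F)
    (hG : ContDiff ℝ ((⊤ : ℕ∞) : WithTop ℕ∞) G) (js : List (Fin 3)) :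
    pderivs js (fun x => F x + G x) = fun x => pderivs js F x + pderivs js G x := by
  induction js generalizing F G with
  | nil => rfl
  | cons j js ih =>
    simp only [pderivs, pderiv_add hF hG]
    exact ih (contDiff_pderiv hF j) (contDiff_pderiv hG j)

/-! ### Cutoffs, and transfer of integrals from the ball to the sphere. -/

/-- Cutoff functions: smooth functions whose support is a compact subset of the punctured open
unit ball. -/
structure IsCutoff (χ : E3 → ℝ) : Prop where
  smooth : ContDiff ℝ ((⊤ : ℕ∞) : WithTop ℕ∞) χ
  supp : tsupport χ ⊆ Metric.ball 0 1 \ {0}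

theorem hasCompactSupport_of_subset {χ : E3 → ℝ} (h : tsupport χ ⊆ Metric.ball 0 1 \ {0}) :
    HasCompactSupport χ :=
  (isCompact_closedBall (0 : E3) 1).of_isClosed_subset (isClosed_tsupport χ)
    (h.trans (Set.sdiff_subset.trans Metric.ball_subset_closedBall))

theorem IsCutoff.contDiff_mul {χ : E3 → ℝ} (hχ : IsCutoff χ) {F : E3 → ℝ}
    (hF : ContDiffOn ℝ ((⊤ : ℕ∞) : WithTop ℕ∞) F {0}ᶜ) :
    ContDiff ℝ ((⊤ : ℕ∞) : WithTop ℕ∞) fun x => χ x * F x := by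
  rw [contDiff_iff_contDiffAt]
  intro x
  by_cases hx : x ∈ tsupport χ
  · exact hχ.smooth.contDiffAt.mul
      (hF.contDiffAt (isOpen_compl_zero.mem_nhds (hχ.supp hx).2))
  · have h := notMem_tsupport_iff_eventuallyEq.1 hx
    refine (contDiffAt_const (c := (0 : ℝ))).congr_of_eventuallyEq ?_
    filter_upwards [h] with y hy
    simp [hy]

theorem IsCutoff.tsupport_mul_subset {χ : E3 → ℝ} (hχ : IsCutoff χ) (F : E3 → ℝ) :
    tsupport (fun x => χ x * F x) ⊆ Metric.ball 0 1 \ {0} :=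
  (tsupport_mul_subset_left).trans hχ.supp

theorem IsCutoff.pderiv {χ : E3 → ℝ} (hχ : IsCutoff χ) (j : Fin 3) : IsCutoff (pderiv j χ) :=
  ⟨contDiff_pderiv hχ.smooth j, (tsupport_pderiv_subset χ j).trans hχ.supp⟩

/-- Each derivative of an extension along rays brings a factor `‖x‖⁻¹`; absorbing it into the cutoff
keeps the class of products closed under differentiation. -/
theorem IsCutoff.mul_inv_norm {χ : E3 → ℝ} (hχ : IsCutoff χ) :
    IsCutoff fun x => χ x * ‖x‖⁻¹ := by
  refine ⟨hχ.contDiff_mul fun x hx => ?_, hχ.tsupport_mul_subset _⟩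
  have hx' : x ≠ 0 := hx
  exact ((contDiffAt_norm ℝ hx').inv (norm_ne_zero_iff.2 hx')).contDiffWithinAt

theorem IsCutoff.pderiv_mul {χ : E3 → ℝ} (hχ : IsCutoff χ) {f : S2 → ℝ} (hf : IsSmooth f)
    (j : Fin 3) :
    CharGluing.pderiv j (fun x => χ x * f (radial x)) =
      fun x => CharGluing.pderiv j χ x * f (radial x) + χ x * ‖x‖⁻¹ * pd j f (radial x) := by
  funext x
  -- At the origin `radial` takes an arbitrary value, but the cutoff vanishes in a neighbourhood.
  by_cases hx : x = 0
  · have hx' : x ∉ tsupport χ := fun h => (hχ.supp h).2 hx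
    have h := notMem_tsupport_iff_eventuallyEq.1 hx'
    have h2 : (fun x => χ x * f (radial x)) =ᶠ[𝓝 x] fun _ => 0 := by
      filter_upwards [h] with y hy
      simp [hy]
    simp only [CharGluing.pderiv]
    rw [h2.fderiv_eq, Filter.EventuallyEq.fderiv_eq h, h.eq_of_nhds]
    simp
  · simp only [CharGluing.pderiv]
    rw [fderiv_fun_mul (hχ.smooth.differentiable (by simp) x)
      (IsCn.differentiableAt hf (by simp) hx)]
    simp only [add_apply, smul_apply, smul_eq_mul]
    rw [fderiv_radial_apply hf (by simp) hx]
    ring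

theorem measurable_radial : Measurable radial :=
  measurable_of_continuousOn_compl_singleton 0 continuousOn_radial

-- The area of `s` is the dimension, 3, times the volume of the open cone over `s` in the unit ball;
-- an inequality is enough, so the factor is dropped.
open scoped Pointwise in
theorem volume_radial_preimage_le {s : Set S2} (hs : MeasurableSet s) :
    volume (radial ⁻¹' s ∩ (Metric.ball (0 : E3) 1 \ {0})) ≤ area s := by
  rw [Measure.toSphere_apply' _ hs]
  have h1 : radial ⁻¹' s ∩ (Metric.ball (0 : E3) 1 \ {0})
      ⊆ Set.Ioo (0 : ℝ) 1 • ((↑) '' s : Set E3) := by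
    rintro x ⟨hx, hx1, hx0⟩
    have hx0' : x ≠ 0 := hx0
    refine Set.mem_smul.2 ⟨‖x‖, ⟨norm_pos_iff.2 hx0', by simpa using hx1⟩, _,
      ⟨radial x, hx, rfl⟩, ?_⟩
    rw [radial_apply hx0', smul_smul, mul_inv_cancel₀ (norm_ne_zero_iff.2 hx0'), one_smul]
  refine (measure_mono h1).trans ?_
  have h3 : (1 : ℝ≥0∞) ≤ (Module.finrank ℝ E3 : ℝ≥0∞) := by simp
  exact le_mul_of_one_le_left (zero_le) h3

theorem setLIntegral_radial_le {H : S2 → ℝ≥0∞} (hH : Measurable H) :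
    ∫⁻ x in Metric.ball (0 : E3) 1 \ {0}, H (radial x) ≤ ∫⁻ p, H p ∂area := by
  rw [← lintegral_map hH measurable_radial]
  refine lintegral_mono' ?_ le_rfl
  refine Measure.le_iff.2 fun s hs => ?_
  rw [Measure.map_apply measurable_radial hs, Measure.restrict_apply (measurable_radial hs)]
  exact volume_radial_preimage_le hs

/-- Cauchy-Schwarz against the constant 1, on a space of finite area. -/
theorem sq_lintegral_le {H : S2 → ℝ≥0∞} (hH : Measurable H) :
    (∫⁻ p, H p ∂area) ^ 2 ≤ area Set.univ * ∫⁻ p, H p ^ 2 ∂area := by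
  have h := ENNReal.lintegral_mul_le_Lp_mul_Lq (area) Real.HolderConjugate.two_two
    (f := fun _ => 1) (g := H) aemeasurable_const hH.aemeasurable
  simp only [Pi.mul_apply, one_mul, ENNReal.rpow_ofNat, one_pow, lintegral_one] at h
  refine (pow_le_pow_left' h 2).trans ?_
  rw [← ENNReal.mul_rpow_of_nonneg _ _ (by norm_num), ← ENNReal.rpow_natCast, ← ENNReal.rpow_mul]
  norm_num

theorem IsCutoff.sq_lintegral_mul_le {χ : E3 → ℝ} (hχ : IsCutoff χ) :
    ∃ C : ℝ≥0∞, C ≠ ∞ ∧ ∀ f : S2 → ℝ, IsSmooth f →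
      (∫⁻ x, ‖χ x * f (radial x)‖ₑ) ^ 2 ≤ C * sob 0 f := by
  obtain ⟨M, hM⟩ := (hχ.smooth.continuous).bounded_above_of_compact_support
    (hasCompactSupport_of_subset hχ.supp)
  refine ⟨ENNReal.ofReal M ^ 2 * area Set.univ,
    ENNReal.mul_ne_top (ENNReal.pow_ne_top ENNReal.ofReal_ne_top) (measure_ne_top _ _),
    fun f hf => ?_⟩
  have hm : Measurable fun p => ‖f p‖ₑ := (IsCn.continuous hf).measurable.enorm
  have h1 : ∫⁻ x, ‖χ x * f (radial x)‖ₑ ≤ ENNReal.ofReal M * ∫⁻ p, ‖f p‖ₑ ∂area := by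
    calc ∫⁻ x, ‖χ x * f (radial x)‖ₑ
        = ∫⁻ x in Metric.ball (0 : E3) 1 \ {0}, ‖χ x * f (radial x)‖ₑ := by
          rw [setLIntegral_eq_of_support_subset]
          intro x hx
          apply hχ.supp
          apply subset_tsupport
          rw [Function.mem_support] at hx ⊢
          intro h
          simp [h] at hx
      _ ≤ ∫⁻ x in Metric.ball (0 : E3) 1 \ {0}, ENNReal.ofReal M * ‖f (radial x)‖ₑ := by
          refine lintegral_mono fun x => ?_
          rw [enorm_mul]
          gcongr
          rw [← ofReal_norm]
          exact ENNReal.ofReal_le_ofReal (hM x)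
      _ ≤ ENNReal.ofReal M * ∫⁻ p, ‖f p‖ₑ ∂area := by
          have hm' : Measurable fun x : E3 => ‖f (radial x)‖ₑ := hm.comp measurable_radial
          rw [lintegral_const_mul _ hm']
          gcongr
          exact setLIntegral_radial_le hm
  calc (∫⁻ x, ‖χ x * f (radial x)‖ₑ) ^ 2
      ≤ (ENNReal.ofReal M * ∫⁻ p, ‖f p‖ₑ ∂area) ^ 2 := pow_le_pow_left' h1 2
    _ = ENNReal.ofReal M ^ 2 * (∫⁻ p, ‖f p‖ₑ ∂area) ^ 2 := mul_pow _ _ _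
    _ ≤ ENNReal.ofReal M ^ 2 * (area Set.univ * sob 0 f) := by
        gcongr
        exact sq_lintegral_le hm
    _ = _ := by rw [mul_assoc]

theorem ennreal_add_sq_le (a b : ℝ≥0∞) : (a + b) ^ 2 ≤ 2 * (a ^ 2 + b ^ 2) := by
  have h := ENNReal.rpow_add_le_mul_rpow_add_rpow a b (p := 2) (by norm_num)
  norm_num at h
  exact h

/-- One derivative turns `χ f` into `(∂χ) f` plus `(χ / ‖x‖) pd f`, both again a cutoff times a
smooth function on the sphere. The induction must therefore run over all cutoffs at once. -/
theorem IsCutoff.sq_lintegral_pderivs_le (js : List (Fin 3)) {χ : E3 → ℝ} (hχ : IsCutoff χ) :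
    ∃ C : ℝ≥0∞, C ≠ ∞ ∧ ∀ f : S2 → ℝ, IsSmooth f →
      (∫⁻ x, ‖pderivs js (fun x => χ x * f (radial x)) x‖ₑ) ^ 2 ≤ C * sob js.length f := by
  induction js generalizing χ with
  | nil => exact hχ.sq_lintegral_mul_le
  | cons j js ih =>
    obtain ⟨C₁, hC₁, h₁⟩ := ih (hχ.pderiv j)
    obtain ⟨C₂, hC₂, h₂⟩ := ih hχ.mul_inv_norm
    refine ⟨2 * (C₁ + C₂), by finiteness, fun f hf => ?_⟩
    have hF := (hχ.pderiv j).contDiff_mul hf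
    have hG := hχ.mul_inv_norm.contDiff_mul (hf.pd j)
    have e : pderivs (j :: js) (fun x => χ x * f (radial x))
        = fun x => pderivs js (fun x => CharGluing.pderiv j χ x * f (radial x)) x
          + pderivs js (fun x => χ x * ‖x‖⁻¹ * pd j f (radial x)) x := by
      rw [pderivs, hχ.pderiv_mul hf]
      exact pderivs_add hF hG js
    rw [e]
    set A := pderivs js (fun x => CharGluing.pderiv j χ x * f (radial x))
    set B := pderivs js (fun x => χ x * ‖x‖⁻¹ * pd j f (radial x))
    have hA : Measurable fun x => ‖A x‖ₑ :=
      (contDiff_pderivs hF js).continuous.measurable.enorm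
    have hs : sob js.length f ≤ sob (j :: js).length f := by
      simp only [List.length_cons, sob]
      exact le_self_add
    have hs' : sob js.length (pd j f) ≤ sob (j :: js).length f := by
      simp only [List.length_cons, sob]
      exact (Finset.single_le_sum (f := fun j => sob js.length (pd j f))
        (fun _ _ => zero_le) (Finset.mem_univ j)).trans le_add_self
    calc (∫⁻ x, ‖A x + B x‖ₑ) ^ 2 ≤ (∫⁻ x, (‖A x‖ₑ + ‖B x‖ₑ)) ^ 2 :=
          pow_le_pow_left' (lintegral_mono fun x => enorm_add_le _ _) 2
      _ = ((∫⁻ x, ‖A x‖ₑ) + (∫⁻ x, ‖B x‖ₑ)) ^ 2 := by rw [lintegral_add_left hA]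
      _ ≤ 2 * ((∫⁻ x, ‖A x‖ₑ) ^ 2 + (∫⁻ x, ‖B x‖ₑ) ^ 2) := ennreal_add_sq_le _ _
      _ ≤ 2 * (C₁ * sob js.length f + C₂ * sob js.length (pd j f)) := by
          gcongr
          · exact h₁ f hf
          · exact h₂ _ (hf.pd j)
      _ ≤ 2 * (C₁ * sob (j :: js).length f + C₂ * sob (j :: js).length f) := by gcongr
      _ = _ := by ring

/-! ### The Euclidean Sobolev bound and its transfer to the sphere. -/

/-- Integration along a coordinate line. -/
theorem enorm_le_lmarginal_pderiv {F : E3 → ℝ} (hF : ContDiff ℝ ((⊤ : ℕ∞) : WithTop ℕ∞) F)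
    (hc : HasCompactSupport F) (j : Fin 3) (y : Fin 3 → ℝ) :
    ‖F (WithLp.toLp 2 y)‖ₑ
      ≤ lmarginal (fun _ => volume) {j} (fun y => ‖pderiv j F (WithLp.toLp 2 y)‖ₑ) y := by
  rw [lmarginal_singleton]
  have hd : ∀ t : ℝ, HasDerivAt (fun t : ℝ => (WithLp.toLp 2 (Function.update y j t) : E3))
      (EuclideanSpace.single j 1) t := by
    intro t
    have h1 := hasDerivAt_update (𝕜 := ℝ) y j t
    have h2 := ((PiLp.continuousLinearEquiv 2 ℝ (fun _ : Fin 3 => ℝ)).symm :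
      (Fin 3 → ℝ) →L[ℝ] E3).hasFDerivAt.comp_hasDerivAt t h1
    exact h2
  have hu : ContDiff ℝ 1 fun t : ℝ => F (WithLp.toLp 2 (Function.update y j t)) := by
    have h1 : ContDiff ℝ 1 fun t : ℝ => (WithLp.toLp 2 (Function.update y j t) : E3) :=
      ((PiLp.continuousLinearEquiv 2 ℝ (fun _ : Fin 3 => ℝ)).symm.contDiff).comp
        (contDiff_update 1 y j)
    exact (hF.of_le (by exact_mod_cast le_top)).comp h1
  have hcu : HasCompactSupport fun t : ℝ => F (WithLp.toLp 2 (Function.update y j t)) := by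
    have h1 : Topology.IsClosedEmbedding
        fun t : ℝ => (WithLp.toLp 2 (Function.update y j t) : E3) :=
      ((PiLp.continuousLinearEquiv 2 ℝ (fun _ : Fin 3 => ℝ)).symm.toHomeomorph.isClosedEmbedding).comp
        (isClosedEmbedding_update y j)
    exact hc.comp_isClosedEmbedding h1
  have h := HasCompactSupport.enorm_le_lintegral_Ici_deriv hu hcu (y j)
  simp only [Function.update_eq_self] at h
  refine h.trans ((setLIntegral_le_lintegral _ _).trans (lintegral_mono fun t => ?_))
  have h3 : HasDerivAt (fun t : ℝ => F (WithLp.toLp 2 (Function.update y j t)))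
      (pderiv j F (WithLp.toLp 2 (Function.update y j t))) t :=
    (hF.differentiable (by simp) _).hasFDerivAt.comp_hasDerivAt t (hd t)
  rw [h3.deriv]

/-- The one-dimensional bound is applied to `F`, `∂₀F` and `∂₁∂₀F` in turn, once along each axis;
the three line integrals then combine to an integral over the whole space. -/
theorem enorm_le_lintegral_pderivs {F : E3 → ℝ} (hF : ContDiff ℝ ((⊤ : ℕ∞) : WithTop ℕ∞) F)
    (hc : HasCompactSupport F) (x : E3) :
    ‖F x‖ₑ ≤ ∫⁻ x, ‖pderivs [0, 1, 2] F x‖ₑ := by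
  have hF0 := contDiff_pderiv hF 0
  have hF1 := contDiff_pderiv hF0 1
  have hF2 := contDiff_pderiv hF1 2
  have hc0 : HasCompactSupport (pderiv 0 F) :=
    hc.of_isClosed_subset (isClosed_tsupport _) (tsupport_pderiv_subset F 0)
  have hc1 : HasCompactSupport (pderiv 1 (pderiv 0 F)) :=
    hc0.of_isClosed_subset (isClosed_tsupport _) (tsupport_pderiv_subset _ 1)
  have hlp : Measurable fun y : Fin 3 → ℝ => (WithLp.toLp 2 y : E3) :=
    (PiLp.continuous_toLp 2 _).measurable
  have m0 : Measurable fun y : Fin 3 → ℝ => ‖pderiv 0 F (WithLp.toLp 2 y)‖ₑ :=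
    (hF0.continuous.measurable.comp hlp).enorm
  have m1 : Measurable fun y : Fin 3 → ℝ => ‖pderiv 1 (pderiv 0 F) (WithLp.toLp 2 y)‖ₑ :=
    (hF1.continuous.measurable.comp hlp).enorm
  have m2 : Measurable
      fun y : Fin 3 → ℝ => ‖pderiv 2 (pderiv 1 (pderiv 0 F)) (WithLp.toLp 2 y)‖ₑ :=
    (hF2.continuous.measurable.comp hlp).enorm
  have h0 := enorm_le_lmarginal_pderiv hF hc 0 (x.ofLp)
  have h1 : lmarginal (fun _ => volume) {0} (fun y => ‖pderiv 0 F (WithLp.toLp 2 y)‖ₑ) ≤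
      lmarginal (fun _ => volume) {0} (lmarginal (fun _ => volume) {1}
        fun y => ‖pderiv 1 (pderiv 0 F) (WithLp.toLp 2 y)‖ₑ) :=
    lmarginal_mono fun y => enorm_le_lmarginal_pderiv hF0 hc0 1 y
  have h2 : lmarginal (fun _ => volume) {0} (lmarginal (fun _ => volume) {1}
        fun y => ‖pderiv 1 (pderiv 0 F) (WithLp.toLp 2 y)‖ₑ) ≤
      lmarginal (fun _ => volume) {0} (lmarginal (fun _ => volume) {1}
        (lmarginal (fun _ => volume) {2}
        fun y => ‖pderiv 2 (pderiv 1 (pderiv 0 F)) (WithLp.toLp 2 y)‖ₑ)) :=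
    lmarginal_mono (lmarginal_mono fun y => enorm_le_lmarginal_pderiv hF1 hc1 2 y)
  have h3 : lmarginal (fun _ => volume) {0} (lmarginal (fun _ => volume) {1}
        (lmarginal (fun _ => volume) {2}
        fun y => ‖pderiv 2 (pderiv 1 (pderiv 0 F)) (WithLp.toLp 2 y)‖ₑ)) x.ofLp
      = ∫⁻ y : Fin 3 → ℝ, ‖pderiv 2 (pderiv 1 (pderiv 0 F)) (WithLp.toLp 2 y)‖ₑ := by
    rw [← lmarginal_union _ _ m2 (by simp), ← lmarginal_union _ _ m2 (by simp)]
    have hu : ({0} ∪ ({1} ∪ {2}) : Finset (Fin 3)) = Finset.univ := by decide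
    rw [hu, lmarginal_univ]
    rfl
  have h4 : ∫⁻ y : Fin 3 → ℝ, ‖pderiv 2 (pderiv 1 (pderiv 0 F)) (WithLp.toLp 2 y)‖ₑ
      = ∫⁻ x, ‖pderivs [0, 1, 2] F x‖ₑ :=
    (EuclideanSpace.volume_preserving_symm_measurableEquiv_toLp (Fin 3)).symm.lintegral_comp
      (f := fun x => ‖pderivs [0, 1, 2] F x‖ₑ) hF2.continuous.measurable.enorm
  exact h0.trans ((h1 _).trans ((h2 _).trans (h3.trans h4).le))

theorem exists_isCutoff : ∃ χ : E3 → ℝ, IsCutoff χ ∧ ∀ x : E3, ‖x‖ = 1 / 2 → χ x = 1 := by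
  -- A bump in `‖x‖²`, which is smooth even at the origin; its support satisfies `3/16 ≤ ‖x‖² ≤
  -- 5/16` and it equals 1 near `‖x‖ = 1/2`.
  let b : ContDiffBump (1 / 4 : ℝ) := ⟨1 / 32, 1 / 16, by norm_num, by norm_num⟩
  refine ⟨fun x => b (‖x‖ ^ 2), ⟨b.contDiff.comp (contDiff_norm_sq ℝ), ?_⟩, fun x hx => ?_⟩
  · have hcl : IsClosed {x : E3 | ‖x‖ ^ 2 ∈ Metric.closedBall (1 / 4 : ℝ) (1 / 16)} :=
      Metric.isClosed_closedBall.preimage (by fun_prop)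
    have h1 : tsupport (fun x : E3 => b (‖x‖ ^ 2))
        ⊆ {x : E3 | ‖x‖ ^ 2 ∈ Metric.closedBall (1 / 4 : ℝ) (1 / 16)} := by
      refine closure_minimal (fun x hx => ?_) hcl
      have : ‖x‖ ^ 2 ∈ Function.support b := hx
      rw [b.support_eq] at this
      exact Metric.ball_subset_closedBall this
    refine h1.trans fun x hx => ?_
    rw [Set.mem_ofPred_eq, Metric.mem_closedBall, Real.dist_eq, abs_le] at hx
    refine ⟨?_, ?_⟩
    · rw [mem_ball_zero_iff]
      nlinarith [norm_nonneg x]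
    · rintro rfl
      norm_num at hx
  · apply b.one_of_mem_closedBall
    rw [hx]
    norm_num [b]

/-- The Sobolev inequality on the sphere, with one derivative more than necessary. -/
theorem exists_enorm_sq_le_sob : ∃ C : ℝ≥0∞, C ≠ ∞ ∧ ∀ f : S2 → ℝ, IsSmooth f → ∀ p,
    ‖f p‖ₑ ^ 2 ≤ C * sob 3 f := by
  obtain ⟨χ, hχ, h1⟩ := exists_isCutoff
  obtain ⟨C, hC, h⟩ := hχ.sq_lintegral_pderivs_le [0, 1, 2]
  refine ⟨C, hC, fun f hf p => ?_⟩
  have hF := hχ.contDiff_mul hf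
  -- The point `p / 2` lies on the ray through `p`, where the cutoff is 1.
  have h2 := enorm_le_lintegral_pderivs hF
    (hasCompactSupport_of_subset (hχ.tsupport_mul_subset _)) ((1 / 2 : ℝ) • (p : E3))
  rw [h1 _ (by rw [norm_smul, norm_coe]; norm_num), one_mul, radial_smul (by norm_num),
    radial_coe] at h2
  exact (pow_le_pow_left' h2 2).trans (h f hf)

/-! ### Sobolev sums of Cartesian components and covariant derivatives -/

theorem IsSmooth.measurable_enorm_sq {f : S2 → ℝ} (hf : IsSmooth f) :
    Measurable fun p => ‖f p‖ₑ ^ 2 := (IsCn.continuous hf).measurable.enorm.pow_const 2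

theorem sob_add_le (m : ℕ) {f g : S2 → ℝ} (hf : IsSmooth f) (hg : IsSmooth g) :
    sob m (fun p => f p + g p) ≤ 2 * (sob m f + sob m g) := by
  induction m generalizing f g with
  | zero =>
    simp only [sob]
    have hm : Measurable fun p => ‖f p‖ₑ ^ 2 + ‖g p‖ₑ ^ 2 :=
      hf.measurable_enorm_sq.add hg.measurable_enorm_sq
    rw [← lintegral_add_left hf.measurable_enorm_sq, ← lintegral_const_mul _ hm]
    exact lintegral_mono fun p =>
      (pow_le_pow_left' (enorm_add_le _ _) 2).trans (ennreal_add_sq_le _ _)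
  | succ m ih =>
    simp only [sob, pd_add hf.isCn_one hg.isCn_one]
    calc _ ≤ 2 * (sob m f + sob m g) + ∑ j, 2 * (sob m (pd j f) + sob m (pd j g)) :=
          add_le_add (ih hf hg) (Finset.sum_le_sum fun j _ => ih (hf.pd j) (hg.pd j))
      _ = _ := by
          rw [← Finset.mul_sum, Finset.sum_add_distrib]
          ring

theorem sob_zero_fun (m : ℕ) : sob m (fun _ => 0) = 0 := by
  induction m with
  | zero => simp [sob]
  | succ m ih => simp [sob, pd_const, ih]

theorem sob_sum_le (m : ℕ) {ι : Type*} (s : Finset ι) {f : ι → S2 → ℝ}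
    (hf : ∀ i, IsSmooth (f i)) :
    sob m (fun p => ∑ i ∈ s, f i p) ≤ 2 ^ s.card * ∑ i ∈ s, sob m (f i) := by
  classical
  induction s using Finset.induction_on with
  | empty => simp [sob_zero_fun]
  | insert a s ha ih =>
    simp only [Finset.sum_insert ha, Finset.card_insert_of_notMem ha]
    calc sob m (fun p => f a p + ∑ i ∈ s, f i p)
        ≤ 2 * (sob m (f a) + sob m (fun p => ∑ i ∈ s, f i p)) :=
          sob_add_le m (hf a) (IsCn.sum fun i _ => hf i)
      _ ≤ 2 * (2 ^ s.card * sob m (f a) + 2 ^ s.card * ∑ i ∈ s, sob m (f i)) := by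
          gcongr
          exact le_mul_of_one_le_left zero_le (one_le_pow_of_one_le' (by norm_num) _)
      _ = _ := by rw [pow_succ]; ring

/-- Leibniz rule and induction on the order; the multiplier varies in the induction since its
derivatives become multipliers. Compactness of the sphere bounds it at order zero. -/
theorem exists_sob_mul_le (m : ℕ) {h : S2 → ℝ} (hh : IsSmooth h) : ∃ C : ℝ≥0∞, C ≠ ∞ ∧
    ∀ f : S2 → ℝ, IsSmooth f → sob m (fun p => h p * f p) ≤ C * sob m f := by
  induction m generalizing h with
  | zero =>
    obtain ⟨M, hM⟩ := isCompact_univ.exists_bound_of_continuousOn (IsCn.continuous hh).continuousOn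
    refine ⟨ENNReal.ofReal M ^ 2, by finiteness, fun f hf => ?_⟩
    simp only [sob]
    rw [← lintegral_const_mul _ hf.measurable_enorm_sq]
    refine lintegral_mono fun p => ?_
    rw [enorm_mul, mul_pow]
    gcongr
    rw [← ofReal_norm]
    exact ENNReal.ofReal_le_ofReal (hM p (Set.mem_univ p))
  | succ m ih =>
    obtain ⟨C, hC, h0⟩ := ih hh
    choose D hD h1 using fun j => ih (hh.pd j)
    refine ⟨C + ∑ j, 2 * (D j + C),
      by simp only [ne_eq, ENNReal.add_eq_top, ENNReal.sum_eq_top]; push Not;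
         exact ⟨hC, fun j _ => ENNReal.mul_ne_top (by simp) (ENNReal.add_ne_top.2 ⟨hD j, hC⟩)⟩,
      fun f hf => ?_⟩
    simp only [sob, pd_mul hh.isCn_one hf.isCn_one]
    have hj : ∀ j, sob m (pd j f) ≤ sob m f + ∑ j, sob m (pd j f) := fun j =>
      (Finset.single_le_sum (f := fun j => sob m (pd j f))
        (fun _ _ => zero_le) (Finset.mem_univ j)).trans le_add_self
    have h0' : sob m f ≤ sob m f + ∑ j, sob m (pd j f) := le_self_add
    rw [add_mul, Finset.sum_mul]
    refine add_le_add ((h0 f hf).trans (by gcongr)) (Finset.sum_le_sum fun j _ => ?_)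
    refine (sob_add_le m ((hh.pd j).mul hf) (hh.mul (hf.pd j))).trans ?_
    rw [mul_assoc, add_mul]
    gcongr
    · exact (h1 j f hf).trans (by gcongr)
    · exact (h0 _ (hf.pd j)).trans (by gcongr; exact hj j)

/-! ### Cartesian components and the round covariant derivative. -/

theorem SmoothField.isSmooth {k : ℕ} {T : TensorField k} (hT : SmoothField T)
    (I : Fin k → Fin 3) : IsSmooth fun p => T p I := contDiffOn_pi.1 hT.2 I

theorem smoothField_of_isSmooth {k : ℕ} {T : TensorField k} (ht : Tangential T)
    (h : ∀ I, IsSmooth fun p => T p I) : SmoothField T := ⟨ht, contDiffOn_pi.2 h⟩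

theorem sum_coord_mul_proj (p : S2) (b : Fin 3) : ∑ a, p.1 a * proj p a b = 0 := by
  have h : ∀ a, p.1 a * proj p a b = (if a = b then p.1 a else 0) - p.1 b * (p.1 a * p.1 a) := by
    intro a
    unfold proj
    split_ifs <;> ring
  simp only [h, Finset.sum_sub_distrib, ← Finset.mul_sum, inner_self_coe]
  simp

theorem proj_comm (p : S2) (a b : Fin 3) : proj p a b = proj p b a := by
  unfold proj
  simp only [eq_comm, mul_comm]

/-- Every slot of `covD T` carries a factor `proj`, which annihilates the normal. -/
theorem covD_tangential {k : ℕ} (T : TensorField k) : Tangential (covD T) := by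
  intro p J s
  simp only [covD, Finset.mul_sum]
  rw [Finset.sum_comm]
  refine Finset.sum_eq_zero fun I _ => ?_
  have h : ∀ a, p.1 a * ((∏ t, proj p (Function.update J s a t) (I t))
        * pd (I 0) (fun q => T q (Fin.tail I)) p)
      = (p.1 a * proj p a (I s)) * ((∏ t ∈ Finset.univ.erase s, proj p (J t) (I t))
        * pd (I 0) (fun q => T q (Fin.tail I)) p) := by
    intro a
    rw [← Finset.mul_prod_erase _ _ (Finset.mem_univ s)]
    rw [Finset.prod_congr rfl (g := fun t => proj p (J t) (I t)) fun t ht => by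
      rw [Function.update_of_ne (Finset.ne_of_mem_erase ht)]]
    simp only [Function.update_self]
    ring
  simp only [h, ← Finset.sum_mul, sum_coord_mul_proj, zero_mul]

theorem IsCn.covD {n m : WithTop ℕ∞} {k : ℕ} {T : TensorField k} (hT : ∀ I, IsCn n fun p => T p I)
    (h : m + 1 ≤ n) (J : Fin (k + 1) → Fin 3) : IsCn m fun p => covD T p J :=
  IsCn.sum fun I _ => (IsCn.prod fun _ _ => isCn_proj _ _).mul ((hT (Fin.tail I)).pd h (I 0))

theorem SmoothField.covD {k : ℕ} {T : TensorField k} (hT : SmoothField T) :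
    SmoothField (covD T) :=
  smoothField_of_isSmooth (covD_tangential T) fun J => IsCn.covD hT.isSmooth (by simp) J

theorem SmoothField.covDIter {k : ℕ} {T : TensorField k} (hT : SmoothField T) (i : ℕ) :
    SmoothField (covDIter i T) := by
  induction i with
  | zero => exact hT
  | succ i ih => exact ih.covD

theorem Tangential.sub {k : ℕ} {T U : TensorField k} (hT : Tangential T) (hU : Tangential U) :
    Tangential (T - U) := by
  intro p I s
  simp only [Pi.sub_apply, mul_sub, Finset.sum_sub_distrib, hT p I s, hU p I s, sub_zero]

theorem SmoothField.sub {k : ℕ} {T U : TensorField k} (hT : SmoothField T) (hU : SmoothField U) :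
    SmoothField (T - U) :=
  smoothField_of_isSmooth (hT.1.sub hU.1) fun I => (hT.isSmooth I).sub (hU.isSmooth I)

theorem covD_sub {k : ℕ} {T U : TensorField k} (hT : ∀ I, IsCn 1 fun p => T p I)
    (hU : ∀ I, IsCn 1 fun p => U p I) : covD (T - U) = covD T - covD U := by
  funext p J
  simp only [covD, Pi.sub_apply, pd_sub (hT _) (hU _), mul_sub, Finset.sum_sub_distrib]

theorem covDIter_sub {k : ℕ} {T U : TensorField k} (hT : SmoothField T) (hU : SmoothField U)
    (i : ℕ) : covDIter i (T - U) = covDIter i T - covDIter i U := by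
  induction i with
  | zero => rfl
  | succ i ih =>
    simp only [covDIter, ih]
    exact covD_sub (fun I => ((hT.covDIter i).isSmooth I).isCn_one)
      (fun I => ((hU.covDIter i).isSmooth I).isCn_one)

/-- The tangential projection fixes tangential tensors. -/
theorem sum_prod_proj_mul {n : ℕ} (p : S2) (G : (Fin n → Fin 3) → ℝ)
    (hG : ∀ I s, ∑ a, p.1 a * G (Function.update I s a) = 0) (J : Fin n → Fin 3) :
    ∑ I : Fin n → Fin 3, (∏ s, proj p (J s) (I s)) * G I = G J := by
  induction n with
  | zero =>
    rw [Fintype.sum_unique, Finset.univ_eq_empty, Finset.prod_empty, one_mul]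
    exact congrArg G (Subsingleton.elim _ _)
  | succ n ih =>
    rw [← (Fin.consEquiv fun _ => Fin 3).sum_comp, Fintype.sum_prod_type]
    have h1 : ∀ a, ∑ I : Fin n → Fin 3, (∏ s, proj p (J s) ((Fin.consEquiv fun _ => Fin 3) (a, I) s))
        * G ((Fin.consEquiv fun _ => Fin 3) (a, I)) = proj p (J 0) a * G (Fin.cons a (Fin.tail J)) := by
      intro a
      rw [← ih (fun I => G (Fin.cons a I)) (fun I s => by
        have := hG (Fin.cons a I) s.succ
        simpa only [← Fin.cons_update] using this) (Fin.tail J), Finset.mul_sum]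
      refine Finset.sum_congr rfl fun I _ => ?_
      simp [Fin.consEquiv, Fin.prod_univ_succ, Fin.tail, mul_assoc]
    simp only [h1]
    have h2 := hG J 0
    have h3 : ∀ a, Function.update J 0 a = Fin.cons a (Fin.tail J) := by
      intro a
      conv_lhs => rw [← Fin.cons_self_tail J, Fin.update_cons_zero]
    simp only [h3] at h2
    -- The normal part of `proj` contracts to zero by tangency in slot 0, leaving the identity.
    simp only [proj, sub_mul, Finset.sum_sub_distrib, mul_assoc, ← Finset.mul_sum, h2]
    simp

/-- A tensor with a normal factor in one slot has no tangential projection. -/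
theorem sum_prod_proj_mul_eq_zero {n : ℕ} (p : S2) (G : (Fin (n + 1) → Fin 3) → ℝ)
    (s : Fin (n + 1)) (hG : ∀ I a, G (Function.update I s a) = G I) (J : Fin (n + 1) → Fin 3) :
    ∑ I : Fin (n + 1) → Fin 3, (∏ t, proj p (J t) (I t)) * (p.1 (I s) * G I) = 0 := by
  -- Summing first over the index in slot `s` isolates the contraction of `proj` with the normal.
  rw [← (Fin.insertNthEquiv (fun _ => Fin 3) s).sum_comp, Fintype.sum_prod_type,
    Finset.sum_comm]
  refine Finset.sum_eq_zero fun I _ => ?_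
  have h : ∀ a, G (s.insertNth a I) = G (s.insertNth 0 I) := by
    intro a
    rw [← hG (s.insertNth 0 I) a, Fin.update_insertNth]
  have h2 : ∀ a, proj p (J s) a * (∏ i, proj p (J (s.succAbove i)) (I i))
      * (p.1 a * G (s.insertNth 0 I))
      = (p.1 a * proj p a (J s)) * ((∏ i, proj p (J (s.succAbove i)) (I i))
      * G (s.insertNth 0 I)) := by
    intro a
    rw [proj_comm p (J s) a]
    ring
  calc _ = ∑ a, (p.1 a * proj p a (J s)) * ((∏ i, proj p (J (s.succAbove i)) (I i))
      * G (s.insertNth 0 I)) := by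
        refine Finset.sum_congr rfl fun a _ => ?_
        rw [← h2 a, ← h a]
        simp only [Fin.insertNthEquiv_apply, Fin.prod_univ_succAbove _ s,
          Fin.insertNth_apply_same, Fin.insertNth_apply_succAbove]
        rfl
    _ = 0 := by rw [← Finset.sum_mul, sum_coord_mul_proj, zero_mul]

/-- This is the derivative of the tangency identity: the derivative of the coordinate `p.1 a` is
`proj`, whose normal part contributes nothing when contracted with `T`. -/
theorem sum_coord_mul_pd_tangential {k : ℕ} {T : TensorField k} (ht : Tangential T)
    (hT : ∀ I, IsCn 1 fun p => T p I) (p : S2) (c : Fin 3) (I : Fin k → Fin 3) (s : Fin k) :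
    ∑ a, p.1 a * pd c (fun q => T q (Function.update I s a)) p
      = -T p (Function.update I s c) := by
  have h0 : pd c (fun q => ∑ a, q.1 a * T q (Function.update I s a)) p = 0 := by
    have : (fun q => ∑ a, q.1 a * T q (Function.update I s a)) = fun _ => 0 :=
      funext fun q => ht q I s
    rw [this, pd_const]
  rw [pd_sum fun a _ => (isCn_coord a).mul (hT _)] at h0
  simp only [pd_mul (isCn_coord _) (hT _), Finset.sum_add_distrib, pd_coord, proj, sub_mul,
    Finset.sum_sub_distrib, mul_assoc, ← Finset.mul_sum, ht p I s] at h0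
  simp at h0
  linarith

/-- The covariant derivative in terms of derivatives of Cartesian components. -/
theorem covD_eq {k : ℕ} {T : TensorField k} (ht : Tangential T)
    (hT : ∀ I, IsCn 1 fun p => T p I) (p : S2) (J : Fin (k + 1) → Fin 3) :
    covD T p J = pd (J 0) (fun q => T q (Fin.tail J)) p
      + ∑ s : Fin k, p.1 (J s.succ) * T p (Function.update (Fin.tail J) s (J 0)) := by
  -- The correction terms make `B` tangential, so the projection fixes `B`; each of them has a
  -- normal factor in one slot, so the projection kills them. Hence `B` is the projection of the
  -- plain derivative, which is `covD T`.
  set B : (Fin (k + 1) → Fin 3) → ℝ := fun J => pd (J 0) (fun q => T q (Fin.tail J)) p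
      + ∑ s : Fin k, p.1 (J s.succ) * T p (Function.update (Fin.tail J) s (J 0)) with hB
  have h1 : ∀ I s, ∑ a, p.1 a * B (Function.update I s a) = 0 := by
    intro I s
    refine Fin.cases ?_ (fun s => ?_) s
    · simp only [hB, mul_add, Finset.sum_add_distrib, Function.update_self, Fin.tail_update_zero]
      rw [sum_coord_mul_pd (hT _), zero_add]
      simp only [Finset.mul_sum]
      rw [Finset.sum_comm]
      refine Finset.sum_eq_zero fun t _ => ?_
      rw [← mul_zero (p.1 (I t.succ)), ← ht p (Fin.tail I) t, Finset.mul_sum]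
      refine Finset.sum_congr rfl fun a _ => ?_
      rw [Function.update_of_ne (Fin.succ_ne_zero t)]
      ring
    · simp only [hB, mul_add, Finset.sum_add_distrib, Fin.tail_update_succ]
      have h0 : ∀ a, Function.update I s.succ a 0 = I 0 := fun a =>
        Function.update_of_ne (Fin.succ_ne_zero s).symm _ _
      simp only [h0]
      rw [sum_coord_mul_pd_tangential ht hT]
      simp only [Finset.mul_sum]
      rw [Finset.sum_comm, Finset.sum_eq_single s]
      · simp only [Function.update_self, Function.update_idem, ← mul_assoc, ← Finset.sum_mul,
          inner_self_coe]
        ring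
      · intro t _ hts
        rw [← mul_zero (p.1 (I t.succ)), ← ht p (Function.update (Fin.tail I) t (I 0)) s,
          Finset.mul_sum]
        refine Finset.sum_congr rfl fun a _ => ?_
        rw [Function.update_of_ne (by simpa using hts), Function.update_comm hts]
        ring
      · simp
  have h2 := sum_prod_proj_mul p B h1 J
  change covD T p J = B J
  rw [← h2]
  simp only [hB, mul_add, Finset.sum_add_distrib, Finset.mul_sum]
  rw [Finset.sum_comm (f := fun (I : Fin (k + 1) → Fin 3) (s : Fin k) => _)]
  rw [Finset.sum_eq_zero (s := (Finset.univ : Finset (Fin k))), add_zero, covD]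
  intro s _
  refine sum_prod_proj_mul_eq_zero p
    (fun I => T p (Function.update (Fin.tail I) s (I 0))) s.succ (fun I a => ?_) J
  simp only [Fin.tail_update_succ, Function.update_idem]
  rw [Function.update_of_ne (Fin.succ_ne_zero s).symm]

/-- The sum of `sob` over the Cartesian components. -/
def sobT (m : ℕ) {k : ℕ} (T : TensorField k) : ℝ≥0∞ := ∑ I, sob m fun p => T p I

theorem sob_le_sobT (m : ℕ) {k : ℕ} (T : TensorField k) (I : Fin k → Fin 3) :
    sob m (fun p => T p I) ≤ sobT m T :=
  Finset.single_le_sum (f := fun I => sob m fun p => T p I) (fun _ _ => zero_le)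
    (Finset.mem_univ I)

/-- Solving `covD_eq` for the plain derivative gives a component of `covD T` minus components of `T`
multiplied by coordinates. -/
theorem exists_sob_pd_le (m k : ℕ) : ∃ C : ℝ≥0∞, C ≠ ∞ ∧ ∀ T : TensorField k, SmoothField T →
    ∀ I j, sob m (pd j fun p => T p I) ≤ C * (sobT m T + sobT m (covD T)) := by
  choose D hD h1 using fun a : Fin 3 => exists_sob_mul_le m (isCn_coord a).neg
  set M := ∑ a, D a with hM
  have hMt : M ≠ ∞ := by simp [hM, ENNReal.sum_eq_top, hD]
  have hDM : ∀ a, D a ≤ M := fun a =>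
    Finset.single_le_sum (f := D) (fun _ _ => zero_le) (Finset.mem_univ a)
  refine ⟨2 * (1 + 2 ^ k * (k * M)), by finiteness, fun T hT I j => ?_⟩
  have hJ : (pd j fun p => T p I) = fun p => covD T p (Fin.cons j I)
      + ∑ s, (-p.1 (I s)) * T p (Function.update I s j) := by
    funext p
    rw [covD_eq hT.1 (fun I => (hT.isSmooth I).isCn_one)]
    simp
  rw [hJ]
  refine (sob_add_le m (hT.covD.isSmooth _)
    (IsCn.sum fun s _ => (isCn_coord (I s)).neg.mul (hT.isSmooth _))).trans ?_
  have h2 : sob m (fun p => ∑ s, (-p.1 (I s)) * T p (Function.update I s j))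
      ≤ 2 ^ k * (k * M) * sobT m T := by
    refine (sob_sum_le m Finset.univ
      fun s => (isCn_coord (I s)).neg.mul (hT.isSmooth (Function.update I s j))).trans ?_
    rw [Finset.card_univ, Fintype.card_fin, mul_assoc]
    gcongr
    calc _ ≤ ∑ _s : Fin k, M * sobT m T := Finset.sum_le_sum fun s _ =>
          (h1 (I s) _ (hT.isSmooth (Function.update I s j))).trans
            (mul_le_mul' (hDM _) (sob_le_sobT m T _))
      _ = k * M * sobT m T := by simp [mul_assoc]
  calc 2 * (sob m (fun p => covD T p (Fin.cons j I))
        + sob m fun p => ∑ s, (-p.1 (I s)) * T p (Function.update I s j))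
      ≤ 2 * (sobT m (covD T) + 2 ^ k * (k * M) * sobT m T) := by
        gcongr
        exact sob_le_sobT m (covD T) _
    _ ≤ 2 * (sobT m (covD T) + sobT m T
        + 2 ^ k * (k * M) * (sobT m T + sobT m (covD T))) := by
        gcongr
        · exact le_self_add
        · exact le_self_add
    _ = _ := by ring

theorem exists_sobT_succ_le (m k : ℕ) : ∃ C : ℝ≥0∞, C ≠ ∞ ∧ ∀ T : TensorField k, SmoothField T →
    sobT (m + 1) T ≤ C * (sobT m T + sobT m (covD T)) := by
  obtain ⟨C, hC, h⟩ := exists_sob_pd_le m k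
  refine ⟨1 + Fintype.card (Fin k → Fin 3) * (3 * C), by finiteness, fun T hT => ?_⟩
  calc sobT (m + 1) T
      = sobT m T + ∑ I : Fin k → Fin 3, ∑ j, sob m (pd j fun p => T p I) := by
        simp only [sobT, sob, Finset.sum_add_distrib]
    _ ≤ (sobT m T + sobT m (covD T)) + ∑ _I : Fin k → Fin 3, ∑ _j : Fin 3,
          C * (sobT m T + sobT m (covD T)) := by
        gcongr with I _ j _
        · exact le_self_add
        · exact h T hT I j
    _ = _ := by
        simp only [Finset.sum_const, Finset.card_univ, Fintype.card_fin, nsmul_eq_mul]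
        push_cast
        ring

theorem sobT_zero_eq {k : ℕ} {T : TensorField k} (hT : SmoothField T) : sobT 0 T = L2sq T := by
  simp only [sobT, sob, L2sq]
  rw [← lintegral_finsetSum _ fun I _ => (hT.isSmooth I).measurable_enorm_sq]
  refine lintegral_congr fun p => ?_
  rw [ENNReal.ofReal_sum_of_nonneg fun I _ => sq_nonneg _]
  refine Finset.sum_congr rfl fun I _ => ?_
  rw [Real.enorm_eq_ofReal_abs, ← ENNReal.ofReal_pow (abs_nonneg _), sq_abs]

/-- Each Cartesian derivative is traded for one more covariant derivative, so the induction on `m`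
needs both `i` and `i + 1`. The case `i = 0` bounds Cartesian Sobolev sums by covariant ones. -/
theorem exists_sobT_covDIter_le (m i k : ℕ) : ∃ C : ℝ≥0∞, C ≠ ∞ ∧
    ∀ T : TensorField k, SmoothField T →
      sobT m (covDIter i T) ≤ C * ∑ i' ∈ Finset.range (i + m + 1), L2sq (covDIter i' T) := by
  induction m generalizing i with
  | zero =>
    refine ⟨1, by simp, fun T hT => ?_⟩
    rw [sobT_zero_eq (hT.covDIter i), one_mul]
    exact Finset.single_le_sum (f := fun i' => L2sq (covDIter i' T)) (fun _ _ => zero_le)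
      (by simp)
  | succ m ih =>
    obtain ⟨C, hC, h⟩ := exists_sobT_succ_le m (k + i)
    obtain ⟨C₁, hC₁, h₁⟩ := ih i
    obtain ⟨C₂, hC₂, h₂⟩ := ih (i + 1)
    refine ⟨C * (C₁ + C₂), by finiteness, fun T hT => ?_⟩
    have e : i + 1 + m + 1 = i + (m + 1) + 1 := by ring
    have hs : ∑ i' ∈ Finset.range (i + m + 1), L2sq (covDIter i' T)
        ≤ ∑ i' ∈ Finset.range (i + (m + 1) + 1), L2sq (covDIter i' T) :=
      Finset.sum_le_sum_of_subset (Finset.range_mono (by omega))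
    have h₂' := h₂ T hT
    rw [e] at h₂'
    calc sobT (m + 1) (covDIter i T)
        ≤ C * (sobT m (covDIter i T) + sobT m (covDIter (i + 1) T)) := h _ (hT.covDIter i)
      _ ≤ C * (C₁ * ∑ i' ∈ Finset.range (i + (m + 1) + 1), L2sq (covDIter i' T)
          + C₂ * ∑ i' ∈ Finset.range (i + (m + 1) + 1), L2sq (covDIter i' T)) := by
          gcongr
          exact (h₁ T hT).trans (by gcongr)
      _ = _ := by ring

/-! ### The Sobolev embedding for tensor fields on the sphere -/

theorem sob_le_succ (m : ℕ) (f : S2 → ℝ) : sob m f ≤ sob (m + 1) f := le_self_add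

theorem sob_mono {m n : ℕ} (h : m ≤ n) (f : S2 → ℝ) : sob m f ≤ sob n f :=
  monotone_nat_of_le_succ (f := fun m => sob m f) (fun m => sob_le_succ m f) h

theorem sob_pd_le (m : ℕ) (f : S2 → ℝ) (j : Fin 3) : sob m (pd j f) ≤ sob (m + 1) f :=
  (Finset.single_le_sum (f := fun j => sob m (pd j f))
    (fun _ _ => zero_le) (Finset.mem_univ j)).trans le_add_self

/-- Cauchy sequences for `sob m`. -/
def SobCauchy (m : ℕ) (f : ℕ → S2 → ℝ) : Prop :=
  Tendsto (fun i : ℕ × ℕ => sob m fun p => f i.1 p - f i.2 p) atTop (𝓝 0)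

theorem SobCauchy.of_le {m n : ℕ} {f : ℕ → S2 → ℝ} (hf : SobCauchy n f) (h : m ≤ n) :
    SobCauchy m f :=
  tendsto_of_tendsto_of_tendsto_of_le_of_le tendsto_const_nhds hf (fun _ => zero_le)
    fun _ => sob_mono h _

theorem SobCauchy.pd {m : ℕ} {f : ℕ → S2 → ℝ} (hf : SobCauchy (m + 1) f)
    (hs : ∀ n, IsSmooth (f n)) (j : Fin 3) : SobCauchy m fun n => pd j (f n) := by
  refine tendsto_of_tendsto_of_tendsto_of_le_of_le tendsto_const_nhds hf (fun _ => zero_le)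
    fun i => ?_
  have h := sob_pd_le m (fun p => f i.1 p - f i.2 p) j
  rwa [pd_sub (hs _).isCn_one (hs _).isCn_one] at h

/-- The Sobolev inequality applied to differences gives a uniform Cauchy sequence. -/
theorem SobCauchy.exists_tendstoUniformly {f : ℕ → S2 → ℝ} (hf : SobCauchy 3 f)
    (hs : ∀ n, IsSmooth (f n)) : ∃ F : S2 → ℝ, TendstoUniformly f F atTop := by
  obtain ⟨C, hC, h⟩ := exists_enorm_sq_le_sob
  have h1 : Tendsto (fun i : ℕ × ℕ => C * sob 3 fun p => f i.1 p - f i.2 p) atTop (𝓝 0) := by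
    simpa using ENNReal.Tendsto.const_mul hf (Or.inr hC)
  have h2 : UniformCauchySeqOn f atTop Set.univ := by
    rw [Metric.uniformCauchySeqOn_iff]
    intro ε hε
    have h3 := h1.eventually_lt_const (u := ENNReal.ofReal ε ^ 2) (by positivity)
    obtain ⟨⟨N₁, N₂⟩, hN⟩ := eventually_atTop.1 h3
    refine ⟨max N₁ N₂, fun m hm n hn p _ => ?_⟩
    have h4 := hN (m, n) ⟨(le_max_left _ _).trans hm, (le_max_right _ _).trans hn⟩
    have h5 := (h _ ((hs m).sub (hs n)) p).trans_lt h4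
    have h6 := lt_of_pow_lt_pow_left' 2 h5
    rwa [← ofReal_norm, ENNReal.ofReal_lt_ofReal_iff hε, ← dist_eq_norm] at h6
  have h3 : ∀ p, ∃ y, Tendsto (fun n => f n p) atTop (𝓝 y) := fun p =>
    cauchySeq_tendsto_of_complete (h2.cauchySeq (Set.mem_univ p))
  choose F hF using h3
  exact ⟨F, tendstoUniformlyOn_univ.1 (h2.tendstoUniformlyOn_of_tendsto fun p _ => hF p)⟩

/-- The differential of the extension constant along rays, in terms of the tangential
derivatives. -/
def radialDeriv (G : Fin 3 → S2 → ℝ) (x : E3) : E3 →L[ℝ] ℝ :=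
  ∑ j, (‖x‖⁻¹ * G j (radial x)) • (EuclideanSpace.proj j : E3 →L[ℝ] ℝ)

theorem hasFDerivAt_radialDeriv {f : S2 → ℝ} (hf : IsSmooth f) {x : E3} (hx : x ≠ 0) :
    HasFDerivAt (fun x : E3 => f (radial x)) (radialDeriv (fun j => pd j f) x) x := by
  have h := (IsCn.differentiableAt hf (by simp) hx).hasFDerivAt
  convert! h using 1
  refine ContinuousLinearMap.coe_injective
    ((EuclideanSpace.basisFun (Fin 3) ℝ).toBasis.ext fun j => ?_)
  simp only [OrthonormalBasis.coe_toBasis, EuclideanSpace.basisFun_apply,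
    ContinuousLinearMap.coe_coe]
  rw [fderiv_radial_apply hf (by simp) hx, radialDeriv]
  simp

theorem contDiffOn_radialDeriv {n : WithTop ℕ∞} {G : Fin 3 → S2 → ℝ} (hG : ∀ j, IsCn n (G j)) :
    ContDiffOn ℝ n (radialDeriv G) {0}ᶜ := by
  refine ContDiffOn.sum fun j _ => ContDiffOn.smul (ContDiffOn.mul ?_ (hG j)) contDiffOn_const
  intro x hx
  have hx' : x ≠ 0 := hx
  exact ((contDiffAt_norm ℝ hx').inv (norm_ne_zero_iff.2 hx')).contDiffWithinAt

/-- A uniform limit of differentials is the differential of the limit. The factor `‖y‖⁻¹` is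
unbounded near the origin, so the argument is confined to `‖y‖ > ‖x‖ / 2`. -/
theorem hasFDerivAt_of_tendstoUniformly_pd {f : ℕ → S2 → ℝ} (hs : ∀ n, IsSmooth (f n))
    {F : S2 → ℝ} (hF : TendstoUniformly f F atTop) {G : Fin 3 → S2 → ℝ}
    (hG : ∀ j, TendstoUniformly (fun n => pd j (f n)) (G j) atTop) {x : E3} (hx : x ≠ 0) :
    HasFDerivAt (fun x : E3 => F (radial x)) (radialDeriv G x) x := by
  set δ := ‖x‖ / 2 with hδ
  have hx' : 0 < ‖x‖ := norm_pos_iff.2 hx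
  have hδ0 : 0 < δ := by positivity
  have ho : IsOpen {y : E3 | δ < ‖y‖} := isOpen_lt continuous_const continuous_norm
  have hxo : x ∈ {y : E3 | δ < ‖y‖} := by
    change δ < ‖x‖
    linarith
  have hne : ∀ y ∈ {y : E3 | δ < ‖y‖}, y ≠ 0 := by
    rintro y hy rfl
    have : δ < ‖(0 : E3)‖ := hy
    simp at this
    linarith
  refine hasFDerivAt_of_tendstoUniformlyOn (f := fun n x => f n (radial x))
    (f' := fun n => radialDeriv fun j => pd j (f n)) ho ?_
    (fun n y hy => hasFDerivAt_radialDeriv (hs n) (hne y hy))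
    (fun y _ => hF.tendsto_at (radial y)) hxo
  set K := ∑ j : Fin 3, ‖(EuclideanSpace.proj j : E3 →L[ℝ] ℝ)‖ with hK
  have hK0 : 0 ≤ K := Finset.sum_nonneg fun _ _ => norm_nonneg _
  rw [Metric.tendstoUniformlyOn_iff]
  intro ε hε
  have hε' : 0 < ε * δ / (K + 1) := by positivity
  have h1 : ∀ᶠ n in atTop, ∀ j, ∀ p, dist (G j p) (pd j (f n) p) < ε * δ / (K + 1) :=
    eventually_all.2 fun j => Metric.tendstoUniformly_iff.1 (hG j) _ hε'
  filter_upwards [h1] with n hn y hy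
  have hy' : δ < ‖y‖ := hy
  have hy0 : 0 < ‖y‖ := hδ0.trans hy'
  rw [dist_eq_norm, radialDeriv, radialDeriv, ← Finset.sum_sub_distrib]
  simp only [← sub_smul, ← mul_sub]
  calc ‖∑ j, (‖y‖⁻¹ * (G j (radial y) - pd j (f n) (radial y))) •
        (EuclideanSpace.proj j : E3 →L[ℝ] ℝ)‖
      ≤ ∑ j, (δ⁻¹ * (ε * δ / (K + 1))) * ‖(EuclideanSpace.proj j : E3 →L[ℝ] ℝ)‖ := by
        refine norm_sum_le_of_le _ fun j _ => ?_
        rw [norm_smul, norm_mul, norm_inv, norm_norm]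
        have h2 := (hn j (radial y)).le
        rw [dist_eq_norm] at h2
        gcongr
    _ = ε * (K / (K + 1)) := by
        rw [← Finset.mul_sum, ← hK]
        field_simp
    _ < ε * 1 := by
        gcongr
        rw [div_lt_one (by positivity)]
        linarith
    _ = ε := mul_one ε

/-- Tangential derivatives of the sequence are Cauchy one order lower, so by induction they converge
uniformly to `C^k` limits, and these form the gradient of the limit. -/
theorem SobCauchy.exists_isCn (k : ℕ) {f : ℕ → S2 → ℝ} (hf : SobCauchy (k + 3) f)
    (hs : ∀ n, IsSmooth (f n)) : ∃ F : S2 → ℝ, IsCn k F ∧ TendstoUniformly f F atTop := by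
  induction k generalizing f with
  | zero =>
    obtain ⟨F, hF⟩ := SobCauchy.exists_tendstoUniformly hf hs
    exact ⟨F, isCn_zero_iff.2 (hF.continuous (Frequently.of_forall fun n => (hs n).continuous)), hF⟩
  | succ k ih =>
    obtain ⟨F, hF⟩ := SobCauchy.exists_tendstoUniformly (hf.of_le (by omega)) hs
    have hf' : SobCauchy (k + 3 + 1) f := hf.of_le (by omega)
    choose G hG hGt using fun j => ih (hf'.pd hs j) fun n => (hs n).pd j
    refine ⟨F, ?_, hF⟩
    have hd : ∀ x ∈ ({0}ᶜ : Set E3),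
        HasFDerivAt (fun x : E3 => F (radial x)) (radialDeriv G x) x :=
      fun x hx => hasFDerivAt_of_tendstoUniformly_pd hs hF hGt hx
    have h : ContDiffOn ℝ ((k : WithTop ℕ∞) + 1) (fun x : E3 => F (radial x)) {0}ᶜ := by
      rw [contDiffOn_succ_iff_fderiv_of_isOpen isOpen_compl_zero]
      refine ⟨fun x hx => (hd x hx).differentiableAt.differentiableWithinAt, by simp, ?_⟩
      exact (contDiffOn_radialDeriv hG).congr fun x hx => (hd x hx).fderiv
    exact_mod_cast h

/-! ### From approximation in `L²` to classical regularity and pointwise bounds. -/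

theorem measurable_sum_sq {k : ℕ} {T : TensorField k} (hT : Measurable T) :
    Measurable fun p => ENNReal.ofReal (∑ I, T p I ^ 2) :=
  (Finset.measurable_fun_sum _ fun I _ =>
    ((measurable_pi_apply I).comp hT).pow_const 2).ennreal_ofReal

theorem L2sq_add_le {k : ℕ} {T U : TensorField k} (hT : Measurable T) (hU : Measurable U) :
    L2sq (T + U) ≤ 2 * (L2sq T + L2sq U) := by
  have hm : Measurable fun p => ENNReal.ofReal (∑ I, T p I ^ 2)
      + ENNReal.ofReal (∑ I, U p I ^ 2) := (measurable_sum_sq hT).add (measurable_sum_sq hU)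
  simp only [L2sq]
  rw [← lintegral_add_left (measurable_sum_sq hT), ← lintegral_const_mul _ hm]
  refine lintegral_mono fun p => ?_
  simp only [Pi.add_apply]
  rw [← ENNReal.ofReal_add (Finset.sum_nonneg fun _ _ => sq_nonneg _)
    (Finset.sum_nonneg fun _ _ => sq_nonneg _), ← ENNReal.ofReal_ofNat 2,
    ← ENNReal.ofReal_mul (by norm_num)]
  refine ENNReal.ofReal_le_ofReal ?_
  rw [← Finset.sum_add_distrib, Finset.mul_sum]
  refine Finset.sum_le_sum fun I _ => ?_
  nlinarith [sq_nonneg (T p I - U p I)]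

theorem L2sq_neg {k : ℕ} (T : TensorField k) : L2sq (-T) = L2sq T := by
  simp [L2sq]

theorem L2sq_sub_le {k : ℕ} {T U V : TensorField k} (hT : Measurable T) (hU : Measurable U)
    (hV : Measurable V) : L2sq (T - U) ≤ 2 * (L2sq (T - V) + L2sq (U - V)) := by
  have h := L2sq_add_le (hT.sub hV) (hU.sub hV).neg
  rw [L2sq_neg] at h
  convert! h using 2
  abel

theorem SmoothField.measurable {k : ℕ} {T : TensorField k} (hT : SmoothField T) : Measurable T :=
  measurable_pi_iff.2 fun I => (hT.isSmooth I).continuous.measurable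

/-- Both members of a pair are compared with `D i`; covariant `L²` norms then control the Cartesian
Sobolev sums. -/
theorem sobCauchy_of_tendsto {k m : ℕ} {D : (i : ℕ) → TensorField (k + i)}
    (hD : ∀ i ≤ m, Measurable (D i)) {Φ : ℕ → TensorField k} (hΦ : ∀ n, SmoothField (Φ n))
    (h : ∀ i ≤ m, Tendsto (fun n => L2sq (covDIter i (Φ n) - D i)) atTop (𝓝 0))
    (I : Fin k → Fin 3) : SobCauchy m fun n p => Φ n p I := by
  obtain ⟨C, hC, hb⟩ := exists_sobT_covDIter_le m 0 k
  have h1 : ∀ i ≤ m, Tendsto (fun n : ℕ × ℕ =>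
      L2sq (covDIter i (Φ n.1) - D i) + L2sq (covDIter i (Φ n.2) - D i)) atTop (𝓝 0) := by
    intro i hi
    rw [← prod_atTop_atTop_eq]
    simpa using ((h i hi).comp tendsto_fst).add ((h i hi).comp tendsto_snd)
  have h2 : Tendsto (fun n : ℕ × ℕ => C * ∑ i ∈ Finset.range (0 + m + 1), 2 *
      (L2sq (covDIter i (Φ n.1) - D i) + L2sq (covDIter i (Φ n.2) - D i))) atTop (𝓝 0) := by
    have h3 := tendsto_finsetSum (Finset.range (0 + m + 1)) fun i hi =>
      ENNReal.Tendsto.const_mul (a := 2) (h1 i (by simp at hi; omega)) (Or.inr (by simp))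
    simpa using ENNReal.Tendsto.const_mul h3 (Or.inr hC)
  refine tendsto_of_tendsto_of_tendsto_of_le_of_le tendsto_const_nhds h2 (fun _ => zero_le)
    fun n => ?_
  refine (sob_le_sobT m (Φ n.1 - Φ n.2) I).trans ((hb _ ((hΦ _).sub (hΦ _))).trans ?_)
  refine mul_le_mul_right (Finset.sum_le_sum fun i hi => ?_) C
  rw [covDIter_sub (hΦ _) (hΦ _)]
  exact L2sq_sub_le ((hΦ _).covDIter i).measurable ((hΦ _).covDIter i).measurable
    (hD i (by simp at hi; omega))

/-- On a space of finite area uniform convergence implies convergence in `L²`, so the two limits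
agree almost everywhere; being continuous, they agree everywhere. -/
theorem eq_of_tendstoUniformly_of_tendsto_L2 {k : ℕ} {T : TensorField k} (hT : Continuous T)
    {Φ : ℕ → TensorField k} (hΦ : ∀ n, SmoothField (Φ n))
    (h : Tendsto (fun n => L2sq (Φ n - T)) atTop (𝓝 0)) (I : Fin k → Fin 3) {F : S2 → ℝ}
    (hFc : Continuous F) (hF : TendstoUniformly (fun n p => Φ n p I) F atTop) :
    F = fun p => T p I := by
  have hTI : Continuous fun p => T p I := (continuous_apply I).comp hT
  have h0 : ∫⁻ p, ‖F p - T p I‖ₑ ^ 2 ∂area = 0 := by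
    refine le_antisymm (ENNReal.le_of_forall_pos_le_add fun ε hε _ => ?_) zero_le
    -- With total area `A`, the integrated uniform error is at most `ε A / (4A + 1) ≤ ε / 4`; the
    -- `L²` error is made at most `ε / 4`, and the factor 2 from squaring a sum gives `ε`.
    have h1 : ∀ᶠ n in atTop, ∀ p, ‖F p - Φ n p I‖ₑ ^ 2 ≤ ENNReal.ofReal ε / (4 * area Set.univ + 1) := by
      have hpos : 0 < ENNReal.ofReal ε / (4 * area Set.univ + 1) :=
        ENNReal.div_pos (by simpa using hε.ne') (by finiteness)
      have hfin : ENNReal.ofReal ε / (4 * area Set.univ + 1) ≠ ∞ :=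
        ENNReal.div_ne_top (by simp) (by simp)
      set c := (ENNReal.ofReal ε / (4 * area Set.univ + 1)).toReal with hc
      have hc0 : 0 < c := ENNReal.toReal_pos hpos.ne' hfin
      filter_upwards [Metric.tendstoUniformly_iff.1 hF (√c) (Real.sqrt_pos.2 hc0)] with n hn p
      rw [← ENNReal.ofReal_toReal hfin, ← hc, Real.enorm_eq_ofReal_abs,
        ← ENNReal.ofReal_pow (abs_nonneg _)]
      refine ENNReal.ofReal_le_ofReal ?_
      have h2 := (hn p).le
      rw [Real.dist_eq] at h2
      calc |F p - Φ n p I| ^ 2 ≤ √c ^ 2 := by gcongr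
        _ = c := Real.sq_sqrt hc0.le
    have h2 := h.eventually_le_const (u := ENNReal.ofReal ε / 4)
      (ENNReal.div_pos (by simpa using hε.ne') (by simp))
    obtain ⟨n, hn1, hn2⟩ := (h1.and h2).exists
    have hm : Measurable fun p => ‖F p - Φ n p I‖ₑ ^ 2 :=
      (hFc.measurable.sub ((hΦ n).isSmooth I).continuous.measurable).enorm.pow_const 2
    have hm2 : Measurable fun p => ‖Φ n p I - T p I‖ₑ ^ 2 :=
      (((hΦ n).isSmooth I).continuous.measurable.sub hTI.measurable).enorm.pow_const 2
    have h3 : ∫⁻ p, ‖Φ n p I - T p I‖ₑ ^ 2 ∂area ≤ L2sq (Φ n - T) := by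
      refine lintegral_mono fun p => ?_
      rw [Real.enorm_eq_ofReal_abs, ← ENNReal.ofReal_pow (abs_nonneg _), sq_abs]
      exact ENNReal.ofReal_le_ofReal (Finset.single_le_sum (f := fun I => (Φ n p I - T p I) ^ 2)
        (fun _ _ => sq_nonneg _) (Finset.mem_univ I))
    calc ∫⁻ p, ‖F p - T p I‖ₑ ^ 2 ∂area
        ≤ ∫⁻ p, 2 * (‖F p - Φ n p I‖ₑ ^ 2 + ‖Φ n p I - T p I‖ₑ ^ 2) ∂area := by
          refine lintegral_mono fun p => ?_
          have := enorm_add_le (F p - Φ n p I) (Φ n p I - T p I)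
          rw [sub_add_sub_cancel] at this
          exact (pow_le_pow_left' this 2).trans (ennreal_add_sq_le _ _)
      _ = 2 * (∫⁻ p, ‖F p - Φ n p I‖ₑ ^ 2 ∂area + ∫⁻ p, ‖Φ n p I - T p I‖ₑ ^ 2 ∂area) := by
          have hm3 : Measurable fun p => ‖F p - Φ n p I‖ₑ ^ 2 + ‖Φ n p I - T p I‖ₑ ^ 2 :=
            hm.add hm2
          rw [lintegral_const_mul _ hm3, lintegral_add_left hm]
      _ ≤ 2 * (ENNReal.ofReal ε / (4 * area Set.univ + 1) * area Set.univ
            + ENNReal.ofReal ε / 4) := by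
          gcongr
          · refine (lintegral_mono hn1).trans ?_
            rw [lintegral_const]
          · exact h3.trans hn2
      _ ≤ 0 + ε := by
          have hA : area Set.univ ≠ ∞ := measure_ne_top _ _
          set a := (area Set.univ).toReal with ha
          have ha0 : 0 ≤ a := ENNReal.toReal_nonneg
          have e1 : area Set.univ = ENNReal.ofReal a := (ENNReal.ofReal_toReal hA).symm
          have e2 : (4 : ℝ≥0∞) * ENNReal.ofReal a + 1 = ENNReal.ofReal (4 * a + 1) := by
            rw [ENNReal.ofReal_add (by positivity) (by norm_num), ENNReal.ofReal_mul (by norm_num)]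
            simp
          have e3 : (4 : ℝ≥0∞) = ENNReal.ofReal 4 := by simp
          have e4 : (2 : ℝ≥0∞) = ENNReal.ofReal 2 := by simp
          rw [e1, e2, e3, ← ENNReal.ofReal_div_of_pos (by positivity),
            ← ENNReal.ofReal_mul (by positivity), ← ENNReal.ofReal_div_of_pos (by norm_num),
            ← ENNReal.ofReal_add (by positivity) (by positivity), e4,
            ← ENNReal.ofReal_mul (by norm_num), zero_add, ← ENNReal.ofReal_coe_nnreal]
          refine ENNReal.ofReal_le_ofReal ?_
          have hε' : (0 : ℝ) < ε := hε
          have : (ε : ℝ) / (4 * a + 1) * a ≤ ε / 4 := by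
            rw [div_mul_eq_mul_div, div_le_div_iff₀ (by positivity) (by norm_num)]
            nlinarith
          linarith
  have hm : Measurable fun p => ‖F p - T p I‖ₑ ^ 2 :=
    (hFc.measurable.sub hTI.measurable).enorm.pow_const 2
  rw [lintegral_eq_zero_iff hm] at h0
  refine (Continuous.ae_eq_iff_eq area hFc hTI).1 ?_
  filter_upwards [h0] with p hp
  simpa [sub_eq_zero] using hp

theorem isCn_and_tendsto_of_approx {k n : ℕ} {T : TensorField k} (hT : Continuous T)
    {D : (i : ℕ) → TensorField (k + i)} (h0 : D 0 = T)
    (hD : ∀ i ≤ n + 3, Measurable (D i)) {Φ : ℕ → TensorField k} (hΦ : ∀ n, SmoothField (Φ n))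
    (h : ∀ i ≤ n + 3, Tendsto (fun n => L2sq (covDIter i (Φ n) - D i)) atTop (𝓝 0))
    (I : Fin k → Fin 3) :
    IsCn n (fun p => T p I) ∧ ∀ p, Tendsto (fun n => Φ n p I) atTop (𝓝 (T p I)) := by
  obtain ⟨F, hF, hFt⟩ := (sobCauchy_of_tendsto hD hΦ h I).exists_isCn n
    fun n => (hΦ n).isSmooth I
  have h00 := h 0 (by omega)
  rw [h0] at h00
  have e := eq_of_tendstoUniformly_of_tendsto_L2 hT hΦ h00 I hF.continuous hFt
  subst e
  exact ⟨hF, fun p => hFt.tendsto_at p⟩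

theorem exists_isSobolevDeriv {r : ℝ} {m k : ℕ} {T : TensorField k} {a : ℝ≥0∞}
    (h : sobolevNorm r m T < a) : ∃ D, IsSobolevDeriv m T D ∧
      (∑ i ∈ Finset.range (m + 1),
        ENNReal.ofReal (r ^ ((2 : ℤ) - 2 * ((k : ℤ) + (i : ℤ)))) * L2sq (D i)) ^ (1 / 2 : ℝ) < a := by
  simp only [sobolevNorm, iInf_lt_iff] at h
  obtain ⟨D, hD, h⟩ := h
  exact ⟨D, hD, h⟩

/-- Continuous tensor fields in `H^(n+3)` are of class `C^n`. -/
theorem isCn_of_sobolevNorm {r : ℝ} {m n k : ℕ} (hmn : n + 3 ≤ m) {T : TensorField k}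
    (hT : Continuous T) (h : sobolevNorm r m T ≠ ∞) (I : Fin k → Fin 3) :
    IsCn n fun p => T p I := by
  obtain ⟨D, ⟨h0, hD, Φ, hΦ, ht⟩, -⟩ := exists_isSobolevDeriv h.lt_top
  exact (isCn_and_tendsto_of_approx hT h0 (fun i hi => hD i (hi.trans hmn)) hΦ
    (fun i hi => ht i (hi.trans hmn)) I).1

/-- Continuous tensor fields that are small in `H^m`, `m ≥ 3`, are pointwise small. -/
theorem exists_enorm_sq_le_sobolevNorm {r : ℝ} (hr : 0 < r) {m : ℕ} (hm : 3 ≤ m) (k : ℕ) :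
    ∃ C : ℝ≥0∞, C ≠ ∞ ∧ ∀ (T : TensorField k) (a : ℝ≥0∞), Continuous T → sobolevNorm r m T < a →
      ∀ p I, ‖T p I‖ₑ ^ 2 ≤ C * a ^ 2 := by
  obtain ⟨C₁, hC₁, h₁⟩ := exists_enorm_sq_le_sob
  obtain ⟨C₂, hC₂, h₂⟩ := exists_sobT_covDIter_le 3 0 k
  set w : ℕ → ℝ≥0∞ := fun i => ENNReal.ofReal (r ^ ((2 : ℤ) - 2 * ((k : ℤ) + (i : ℤ)))) with hw
  have hw0 : ∀ i, w i ≠ 0 := fun i => by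
    simp only [hw, ne_eq, ENNReal.ofReal_eq_zero, not_le]
    positivity
  have hwt : ∀ i, w i ≠ ∞ := fun i => ENNReal.ofReal_ne_top
  -- Only the orders 0 to 3 enter. The inverse weights undo the powers of `r` in the norm, and the
  -- factor 2 comes from `L2sq_add_le`.
  refine ⟨C₁ * (C₂ * ∑ i ∈ Finset.range 4, 2 * (w i)⁻¹), ?_, fun T a hT h p I => ?_⟩
  · refine ENNReal.mul_ne_top hC₁ (ENNReal.mul_ne_top hC₂ (ENNReal.sum_ne_top.2 fun i _ => ?_))
    exact ENNReal.mul_ne_top (by simp) (ENNReal.inv_ne_top.2 (hw0 i))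
  obtain ⟨D, ⟨h0, hD, Φ, hΦ, ht⟩, ha⟩ := exists_isSobolevDeriv h
  have hlim := (isCn_and_tendsto_of_approx (n := 0) hT h0 (fun i hi => hD i (by omega)) hΦ
    (fun i hi => ht i (by omega)) I).2 p
  have hsum : ∑ i ∈ Finset.range (m + 1), w i * L2sq (D i) ≤ a ^ 2 := by
    have h3 := (ENNReal.rpow_le_rpow ha.le (by norm_num : (0 : ℝ) ≤ 2))
    rw [← ENNReal.rpow_mul] at h3
    norm_num at h3
    exact h3
  have hDi : ∀ i ∈ Finset.range 4, L2sq (D i) ≤ (w i)⁻¹ * a ^ 2 := by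
    intro i hi
    have h3 : w i * L2sq (D i) ≤ a ^ 2 :=
      (Finset.single_le_sum (f := fun i => w i * L2sq (D i)) (fun _ _ => zero_le)
        (by simp at hi ⊢; omega)).trans hsum
    calc L2sq (D i) = (w i)⁻¹ * (w i * L2sq (D i)) := by
          rw [← mul_assoc, ENNReal.inv_mul_cancel (hw0 i) (hwt i), one_mul]
      _ ≤ _ := by gcongr
  have hlim2 : Tendsto (fun n => ‖Φ n p I‖ₑ ^ 2) atTop (𝓝 (‖T p I‖ₑ ^ 2)) :=
    ENNReal.Tendsto.pow (n := 2) hlim.enorm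
  -- The inequality is available for the smooth approximants only; splitting off their distance to
  -- `D i` lets it pass to the limit.
  have hlim3 : Tendsto (fun n => C₁ * (C₂ * ∑ i ∈ Finset.range 4,
      2 * (L2sq (covDIter i (Φ n) - D i) + L2sq (D i)))) atTop
      (𝓝 (C₁ * (C₂ * ∑ i ∈ Finset.range 4, 2 * (0 + L2sq (D i))))) := by
    refine ENNReal.Tendsto.const_mul (ENNReal.Tendsto.const_mul ?_ (Or.inr hC₂)) (Or.inr hC₁)
    refine tendsto_finsetSum _ fun i hi => ENNReal.Tendsto.const_mul ?_ (Or.inr (by simp))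
    exact (ht i (by simp at hi; omega)).add tendsto_const_nhds
  have hle : ∀ n, ‖Φ n p I‖ₑ ^ 2 ≤ C₁ * (C₂ * ∑ i ∈ Finset.range 4,
      2 * (L2sq (covDIter i (Φ n) - D i) + L2sq (D i))) := by
    intro n
    refine (h₁ _ ((hΦ n).isSmooth I) p).trans ?_
    gcongr
    refine (sob_le_sobT 3 (Φ n) I).trans ((h₂ _ (hΦ n)).trans ?_)
    gcongr with i hi
    have hm1 := ((hΦ n).covDIter i).measurable
    have hm2 := hD i (by simp at hi; omega)
    have := L2sq_add_le (hm1.sub hm2) hm2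
    rwa [sub_add_cancel] at this
  refine (le_of_tendsto_of_tendsto' hlim2 hlim3 hle).trans ?_
  rw [mul_assoc, mul_assoc, Finset.sum_mul]
  refine mul_le_mul_right (mul_le_mul_right (Finset.sum_le_sum fun i hi => ?_) C₂) C₁
  rw [zero_add, mul_assoc]
  exact mul_le_mul_right (hDi i hi) 2

/-! ### Regularity of the geometric operations -/

theorem IsMetric.sum_coord_left {g : TensorField 2} (hg : IsMetric g) (p : S2) (b : Fin 3) :
    ∑ a, p.1 a * g p ![a, b] = 0 := by
  have h := hg.tang p ![0, b] 0
  refine Eq.trans (Finset.sum_congr rfl fun a _ => ?_) h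
  congr 2
  funext i
  fin_cases i <;> rfl

/-- The quadratic form of `g` only sees the tangential part of a vector. -/
theorem IsMetric.sum_sub_normal {g : TensorField 2} (hg : IsMetric g) (p : S2) (w : Fin 3 → ℝ)
    (c : ℝ) : ∑ a, ∑ b, g p ![a, b] * (w a - c * p.1 a) * (w b - c * p.1 b)
      = ∑ a, ∑ b, g p ![a, b] * w a * w b := by
  have h0 := hg.sum_coord_left p 0
  have h1 := hg.sum_coord_left p 1
  have h2 := hg.sum_coord_left p 2
  have s01 := hg.symm p 0 1
  have s02 := hg.symm p 0 2
  have s12 := hg.symm p 1 2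
  simp only [Fin.sum_univ_three] at *
  rw [← s01] at h0
  rw [← s02] at h0
  rw [← s12] at h1
  rw [← s01, ← s02, ← s12]
  linear_combination (c ^ 2 * p.1 0 - 2 * c * w 0) * h0 + (c ^ 2 * p.1 1 - 2 * c * w 1) * h1
    + (c ^ 2 * p.1 2 - 2 * c * w 2) * h2

/-- With `c` the normal component of `w`, the form is `g` on the tangential part of `w` plus `c²`,
and one of the two is positive. -/
theorem IsMetric.fullMatrix_posDef {g : TensorField 2} (hg : IsMetric g) (p : S2) :
    (fullMatrix g p).PosDef := by
  refine Matrix.PosDef.of_dotProduct_mulVec_pos ?_ fun w hw => ?_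
  · ext a b
    simp [fullMatrix, hg.symm p b a, mul_comm]
  · set c := ∑ a, p.1 a * w a with hc
    have e : star w ⬝ᵥ (fullMatrix g p).mulVec w
        = ∑ a, ∑ b, g p ![a, b] * (w a - c * p.1 a) * (w b - c * p.1 b) + c ^ 2 := by
      rw [hg.sum_sub_normal]
      simp only [dotProduct, Matrix.mulVec, fullMatrix, hc, Fin.sum_univ_three, Matrix.of_apply,
        Pi.star_apply, star_trivial]
      ring
    rw [e]
    by_cases h : (fun a => w a - c * p.1 a) = 0
    · have hcne : c ≠ 0 := by
        intro h0
        apply hw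
        funext a
        have := congrFun h a
        simpa [h0] using this
      have h1 : ∀ a, w a - c * p.1 a = 0 := fun a => congrFun h a
      simp only [h1]
      simp
      positivity
    · have ht : ∑ a, p.1 a * (w a - c * p.1 a) = 0 := by
        have h1 : ∀ a, p.1 a * (w a - c * p.1 a) = p.1 a * w a - c * (p.1 a * p.1 a) := by
          intro a
          ring
        simp only [h1, Finset.sum_sub_distrib, ← Finset.mul_sum, inner_self_coe, ← hc]
        ring
      have := hg.pos p _ h ht
      positivity

theorem IsMetric.det_pos {g : TensorField 2} (hg : IsMetric g) (p : S2) :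
    0 < (fullMatrix g p).det := (hg.fullMatrix_posDef p).det_pos

theorem isCn_det {n : WithTop ℕ∞} {M : S2 → Matrix (Fin 3) (Fin 3) ℝ}
    (hM : ∀ a b, IsCn n fun p => M p a b) : IsCn n fun p => (M p).det := by
  simp only [Matrix.det_apply']
  exact IsCn.sum fun σ _ => (isCn_const _).mul (IsCn.prod fun i _ => hM _ _)

theorem isCn_fullMatrix {n : WithTop ℕ∞} {g : TensorField 2} (hg : ∀ I, IsCn n fun p => g p I)
    (a b : Fin 3) : IsCn n fun p => fullMatrix g p a b :=
  (hg ![a, b]).add ((isCn_coord a).mul (isCn_coord b))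

theorem isCn_ginv {n : WithTop ℕ∞} {g : TensorField 2} (hm : IsMetric g)
    (hg : ∀ I, IsCn n fun p => g p I) (a b : Fin 3) : IsCn n fun p => ginv g p a b := by
  refine IsCn.sub ?_ ((isCn_coord a).mul (isCn_coord b))
  -- Cramer's rule writes the inverse as a quotient of polynomials in the entries.
  have h : ∀ p, (fullMatrix g p)⁻¹ a b
      = (fullMatrix g p).det⁻¹ * ((fullMatrix g p).updateRow b (Pi.single a 1)).det := by
    intro p
    rw [Matrix.inv_def, Matrix.smul_apply, Ring.inverse_eq_inv', Matrix.adjugate_apply, smul_eq_mul]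
  simp only [h]
  refine ((isCn_det (isCn_fullMatrix hg)).inv fun p => (hm.det_pos p).ne').mul
    (isCn_det fun c d => ?_)
  simp only [Matrix.updateRow_apply]
  by_cases hcb : c = b
  · simpa [hcb] using isCn_const _
  · simpa [hcb] using isCn_fullMatrix hg c d

theorem isCn_christoffel {m n : WithTop ℕ∞} {g : TensorField 2} (hm : IsMetric g)
    (hg : ∀ I, IsCn n fun p => g p I) (h : m + 1 ≤ n) (I : Fin 3 → Fin 3) :
    IsCn m fun p => christoffel g p I := by
  have hmn : m ≤ n := le_self_add.trans h
  refine (isCn_const _).mul (IsCn.sum fun d _ => ?_)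
  exact (isCn_ginv hm (fun I => (hg I).of_le hmn) _ _).mul
    (((IsCn.covD hg h _).add (IsCn.covD hg h _)).sub (IsCn.covD hg h _))

theorem isCn_covDg {m n : WithTop ℕ∞} {g : TensorField 2} (hm : IsMetric g)
    (hg : ∀ I, IsCn n fun p => g p I) (h : m + 1 ≤ n) {k : ℕ} {T : TensorField k}
    (hT : ∀ I, IsCn n fun p => T p I) (J : Fin (k + 1) → Fin 3) :
    IsCn m fun p => covDg g T p J := by
  have hmn : m ≤ n := le_self_add.trans h
  refine (IsCn.covD hT h J).sub (IsCn.sum fun s _ => IsCn.sum fun c _ => ?_)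
  exact (isCn_christoffel hm hg h _).mul ((hT _).of_le hmn)

theorem isCn_divg {m n : WithTop ℕ∞} {g : TensorField 2} (hm : IsMetric g)
    (hg : ∀ I, IsCn n fun p => g p I) (h : m + 1 ≤ n) {X : TensorField 1}
    (hX : ∀ I, IsCn n fun p => X p I) : IsCn m (divg g X) :=
  IsCn.sum fun a _ => IsCn.sum fun b _ =>
    (isCn_ginv hm (fun I => (hg I).of_le (le_self_add.trans h)) a b).mul
      (isCn_covDg hm hg h hX _)

theorem isCn_divg2 {m n : WithTop ℕ∞} {g : TensorField 2} (hm : IsMetric g)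
    (hg : ∀ I, IsCn n fun p => g p I) (h : m + 1 ≤ n) {V : TensorField 2}
    (hV : ∀ I, IsCn n fun p => V p I) (I : Fin 1 → Fin 3) : IsCn m fun p => divg2 g V p I :=
  IsCn.sum fun b _ => IsCn.sum fun c _ =>
    (isCn_ginv hm (fun I => (hg I).of_le (le_self_add.trans h)) b c).mul
      (isCn_covDg hm hg h hV _)

theorem isCn_contractg {n : WithTop ℕ∞} {g : TensorField 2} (hm : IsMetric g)
    (hg : ∀ I, IsCn n fun p => g p I) {V : TensorField 2} (hV : ∀ I, IsCn n fun p => V p I)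
    {X : TensorField 1} (hX : ∀ I, IsCn n fun p => X p I) (I : Fin 1 → Fin 3) :
    IsCn n fun p => contractg g V X p I :=
  IsCn.sum fun b _ => IsCn.sum fun c _ => ((hV _).mul (isCn_ginv hm hg b c)).mul (hX _)

theorem isCn_innerg {n : WithTop ℕ∞} {g : TensorField 2} (hm : IsMetric g)
    (hg : ∀ I, IsCn n fun p => g p I) {V W : TensorField 2} (hV : ∀ I, IsCn n fun p => V p I)
    (hW : ∀ I, IsCn n fun p => W p I) : IsCn n (innerg g V W) :=
  IsCn.sum fun a _ => IsCn.sum fun b _ => IsCn.sum fun c _ => IsCn.sum fun d _ =>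
    (((isCn_ginv hm hg a c).mul (isCn_ginv hm hg b d)).mul (hV _)).mul (hW _)

theorem isCn_gaussCurvature {l m n : WithTop ℕ∞} {g : TensorField 2} (hm : IsMetric g)
    (hg : ∀ I, IsCn n fun p => g p I) (h : m + 1 ≤ n) (h' : l + 1 ≤ m) :
    IsCn l (gaussCurvature g) := by
  have hlm : l ≤ m := le_self_add.trans h'
  have hmn : m ≤ n := le_self_add.trans h
  have hC : ∀ I, IsCn m fun p => christoffel g p I := isCn_christoffel hm hg h
  have hC' : ∀ I, IsCn l fun p => christoffel g p I := fun I => (hC I).of_le hlm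
  refine (isCn_const _).mul (IsCn.sum fun a _ => IsCn.sum fun b _ =>
    (isCn_ginv hm (fun I => (hg I).of_le (hlm.trans hmn)) a b).mul ?_)
  exact ((((isCn_proj a b).add (IsCn.sum fun c _ => IsCn.covD hC h' _)).sub
    (IsCn.sum fun c _ => IsCn.covD hC h' _)).add
    (IsCn.sum fun c _ => IsCn.sum fun e _ => (hC' _).mul (hC' _))).sub
    (IsCn.sum fun c _ => IsCn.sum fun e _ => (hC' _).mul (hC' _))

theorem isCn_dS {m n : WithTop ℕ∞} {f : S2 → ℝ} (hf : IsCn n f) (h : m + 1 ≤ n)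
    (I : Fin 1 → Fin 3) : IsCn m fun p => dS f p I := hf.pd h (I 0)

/-! ### Sphere data of finite norm -/

/-- Sphere data that are regular enough for the charges to be integrals of continuous functions. -/
structure IsRegularData (x : SphereTuple) : Prop extends IsSphereData x where
  Ω_reg : IsCn 2 x.Ω
  g_reg : ∀ I, IsCn 2 fun p => x.g p I
  Ωtrχ_reg : IsCn 2 x.Ωtrχ
  χhat_reg : ∀ I, IsCn 2 fun p => x.χhat p I
  η_reg : ∀ I, IsCn 1 fun p => x.η p I

theorem continuous_of_isCn {k : ℕ} {n : WithTop ℕ∞} {T : TensorField k}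
    (hT : ∀ I, IsCn n fun p => T p I) : Continuous T :=
  continuous_pi fun I => (hT I).continuous

theorem isCn_roundMetric {n : WithTop ℕ∞} (I : Fin 2 → Fin 3) :
    IsCn n fun p => roundMetric p I := isCn_proj _ _

/-- Subtracting the smooth Minkowski data does not affect regularity. The embedding costs three
derivatives, so `H⁶` gives the required `C²`, and `H⁵` the `C¹` required of `η`. -/
theorem IsSphereData.isRegularData {u v : ℝ} {x : SphereTuple} (hx : IsSphereData x)
    (h : normX u v (x - minkowski u v) ≠ ∞) : IsRegularData x := by
  simp only [normX, ENNReal.add_eq_top, ne_eq, not_or] at h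
  obtain ⟨⟨⟨⟨⟨⟨⟨⟨⟨⟨⟨⟨h1, h2⟩, h3⟩, h4⟩, -⟩, -⟩, h7⟩, -⟩, -⟩, -⟩, -⟩, -⟩, -⟩ := h
  have hround : Continuous ((v - u) ^ 2 • roundMetric) :=
    (continuous_of_isCn (n := 0) isCn_roundMetric).const_smul _
  have r1 := isCn_of_sobolevNorm (n := 2) (by norm_num)
    (continuous_pi fun _ => hx.Ω_cont.sub continuous_const) h1
  have r2 := isCn_of_sobolevNorm (n := 2) (by norm_num) (hx.g_metric.cont.sub hround) h2
  have r3 := isCn_of_sobolevNorm (n := 2) (by norm_num)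
    (continuous_pi fun _ => hx.Ωtrχ_cont.sub continuous_const) h3
  have r4 := isCn_of_sobolevNorm (n := 2) (by norm_num) (hx.χhat_stf.cont.sub continuous_zero) h4
  have r7 := isCn_of_sobolevNorm (n := 1) (by norm_num) (hx.η_cont.sub continuous_zero) h7
  refine ⟨hx, ?_, fun I => ?_, ?_, fun I => ?_, fun I => ?_⟩
  · have := (r1 ![]).add (isCn_const 1)
    exact this.congr fun y _ => (sub_add_cancel _ _).symm
  · have := (r2 I).add ((isCn_const ((v - u) ^ 2)).mul (isCn_roundMetric I))
    exact this.congr fun y _ => (sub_add_cancel _ _).symm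
  · have := (r3 ![]).add (isCn_const (2 / (v - u)))
    exact this.congr fun y _ => (sub_add_cancel _ _).symm
  · exact (r4 I).congr fun y _ => (sub_zero _).symm
  · have := (r7 I).congr (f₁ := fun y : E3 => x.η (radial y) I) fun y _ => (sub_zero _).symm
    exact_mod_cast this

theorem IsRegularData.isCn_trχ {x : SphereTuple} (hx : IsRegularData x) : IsCn 2 (trχ x) :=
  hx.Ωtrχ_reg.div hx.Ω_reg fun p => (hx.Ω_pos p).ne'

theorem two_bound : (1 : WithTop ℕ∞) + 1 ≤ 2 := by norm_num

theorem IsRegularData.isCn_dlog {x : SphereTuple} (hx : IsRegularData x) (I : Fin 1 → Fin 3) :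
    IsCn 1 fun p => dS (fun q => Real.log (x.Ω q)) p I :=
  isCn_dS (hx.Ω_reg.log fun p => (hx.Ω_pos p).ne') two_bound I

theorem IsRegularData.isCn_ζ {x : SphereTuple} (hx : IsRegularData x) (I : Fin 1 → Fin 3) :
    IsCn 1 fun p => ζ x p I := (hx.η_reg I).sub (hx.isCn_dlog I)

theorem IsRegularData.isCn_β {x : SphereTuple} (hx : IsRegularData x) (I : Fin 1 → Fin 3) :
    IsCn 1 fun p => β x p I := by
  have hg1 : ∀ I, IsCn 1 fun p => x.g p I := fun I => (hx.g_reg I).of_le one_le_two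
  have hχ1 : ∀ I, IsCn 1 fun p => x.χhat p I := fun I => (hx.χhat_reg I).of_le one_le_two
  exact ((((isCn_divg2 hx.g_metric hx.g_reg two_bound hx.χhat_reg I).sub
    ((isCn_const _).mul (isCn_dS hx.isCn_trχ two_bound I))).add
    (isCn_contractg hx.g_metric hg1 hχ1 hx.isCn_ζ I)).sub
    (((isCn_const _).mul (hx.isCn_trχ.of_le one_le_two)).mul (hx.isCn_ζ I))).neg

theorem IsRegularData.continuous_ρ {x : SphereTuple} (hx : IsRegularData x) :
    Continuous (ρ x) := by
  have hb : Continuous (trχbar x) := hx.Ωtrχbar_cont.div hx.Ω_cont fun p => (hx.Ω_pos p).ne'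
  have hK : Continuous (gaussCurvature x.g) :=
    (isCn_gaussCurvature (l := 0) (m := 1) hx.g_metric hx.g_reg two_bound (by norm_num)).continuous
  have hi : Continuous (innerg x.g x.χhat x.χhatbar) :=
    (isCn_innerg (n := 0) hx.g_metric (fun I => (hx.g_reg I).of_le zero_le)
      (fun I => (hx.χhat_reg I).of_le zero_le)
      (fun I => isCn_zero_iff.2 ((continuous_apply I).comp hx.χhatbar_stf.cont))).continuous
  have ht := hx.isCn_trχ.continuous
  unfold ρ
  fun_prop

theorem IsRegularData.continuous_chargeScalar {x : SphereTuple} (hx : IsRegularData x) :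
    Continuous (chargeScalar x) := by
  have h1 := hx.continuous_ρ
  have h2 : Continuous (divg x.g (β x)) :=
    (isCn_divg (m := 0) (n := 1) hx.g_metric (fun I => (hx.g_reg I).of_le one_le_two)
      (by norm_num) hx.isCn_β).continuous
  unfold chargeScalar
  fun_prop

theorem IsRegularData.continuous_chargeForm {x : SphereTuple} (hx : IsRegularData x)
    (I : Fin 1 → Fin 3) : Continuous fun p => chargeForm x p I := by
  have h1 : Continuous fun p => dS (trχ x) p I :=
    (isCn_dS hx.isCn_trχ two_bound I).continuous
  have h2 := (hx.isCn_dlog I).continuous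
  have h3 := hx.isCn_trχ.continuous
  have h4 := (hx.η_reg I).continuous
  unfold chargeForm
  fun_prop

theorem integrable_of_continuous {f : S2 → ℝ} (hf : Continuous f) : Integrable f area :=
  hf.integrable_of_hasCompactSupport (HasCompactSupport.of_compactSpace f)

theorem IsMetric.areaDensity_pos {g : TensorField 2} (hg : IsMetric g) (p : S2) :
    0 < areaDensity g p := Real.sqrt_pos.2 (hg.det_pos p)

theorem IsMetric.confFactor_pos {g : TensorField 2} (hg : IsMetric g) (p : S2) :
    0 < confFactor g p := Real.sqrt_pos.2 (hg.areaDensity_pos p)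

theorem IsMetric.areaRadius_pos {g : TensorField 2} (hg : IsMetric g) : 0 < areaRadius g := by
  have hc : Continuous (areaDensity g) := by
    have h : IsCn 0 fun p => (fullMatrix g p).det :=
      isCn_det (isCn_fullMatrix fun I => isCn_zero_iff.2 ((continuous_apply I).comp hg.cont))
    exact Real.continuous_sqrt.comp h.continuous
  have hI : 0 < ∫ p, areaDensity g p ∂area :=
    hc.integral_pos_of_hasCompactSupport_nonneg_nonzero (HasCompactSupport.of_compactSpace _)
      (fun p => (hg.areaDensity_pos p).le)
      (x := ⟨EuclideanSpace.single 2 1, by simp⟩) (hg.areaDensity_pos _).ne'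
  exact Real.sqrt_pos.2 (by positivity)

/-! ### The charges determine the low modes -/

/-- A combination of the `Z i` that is orthogonal to each `Z i` in the weighted `L²` product is
orthogonal to itself. Its weighted square has zero integral, hence vanishes by continuity. Linear
independence of the `Z i` plays no role. -/
theorem sum_mul_eq_zero_of_integral {ι J : Type*} [Fintype ι] [Fintype J] {Z : ι → S2 → J → ℝ}
    (hZ : ∀ i a, Continuous fun p => Z i p a) {w : S2 → ℝ} (hw : Continuous w)
    (hpos : ∀ p, 0 < w p) (c : ι → ℝ)
    (h : ∀ i, ∫ p, w p * ∑ a, (∑ j, c j * Z j p a) * Z i p a ∂area = 0) (p : S2) (a : J) :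
    ∑ j, c j * Z j p a = 0 := by
  set δ : S2 → J → ℝ := fun p a => ∑ j, c j * Z j p a with hδ
  have hδc : ∀ a, Continuous fun p => δ p a := fun a =>
    continuous_finsetSum _ fun j _ => continuous_const.mul (hZ j a)
  have hc : Continuous fun p => w p * ∑ a, δ p a * δ p a :=
    hw.mul (continuous_finsetSum _ fun a _ => (hδc a).mul (hδc a))
  have hnn : ∀ p, 0 ≤ w p * ∑ a, δ p a * δ p a := fun p =>
    mul_nonneg (hpos p).le (Finset.sum_nonneg fun a _ => mul_self_nonneg _)
  have hI : ∫ p, w p * ∑ a, δ p a * δ p a ∂area = 0 := by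
    have e : ∀ p, w p * ∑ a, δ p a * δ p a = ∑ i, c i * (w p * ∑ a, δ p a * Z i p a) := by
      intro p
      have e1 : ∀ a, δ p a * δ p a = ∑ i, c i * (δ p a * Z i p a) := by
        intro a
        change δ p a * ∑ i, c i * Z i p a = _
        rw [Finset.mul_sum]
        exact Finset.sum_congr rfl fun i _ => by ring
      simp only [e1]
      rw [Finset.sum_comm, Finset.mul_sum]
      refine Finset.sum_congr rfl fun i _ => ?_
      rw [← Finset.mul_sum]
      ring
    simp only [e]
    have hi : ∀ i, Integrable (fun p => c i * (w p * ∑ a, δ p a * Z i p a)) area := fun i =>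
      integrable_of_continuous (continuous_const.mul
        (hw.mul (continuous_finsetSum _ fun a _ => (hδc a).mul (hZ i a))))
    rw [integral_finsetSum _ fun i _ => hi i]
    refine Finset.sum_eq_zero fun i _ => ?_
    rw [integral_const_mul, h i, mul_zero]
  have h0 : w p * ∑ a, δ p a * δ p a = 0 := by
    by_contra hne
    exact (hc.integral_pos_of_hasCompactSupport_nonneg_nonzero
      (HasCompactSupport.of_compactSpace _) hnn hne).ne' hI
  have h1 := (mul_eq_zero.1 h0).resolve_left (hpos p).ne'
  have h2 := (Finset.sum_eq_zero_iff_of_nonneg fun a _ => mul_self_nonneg (δ p a)).1 h1 a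
    (Finset.mem_univ a)
  exact mul_self_eq_zero.1 h2

theorem continuous_Y1 (m : Fin 3) : Continuous (Y1 m) :=
  continuous_const.mul (isCn_coord (n := 0) _).continuous

theorem isCn_Y1 {n : WithTop ℕ∞} (m : Fin 3) : IsCn n (Y1 m) :=
  (isCn_const _).mul (isCn_coord _)

theorem continuous_dS_Y1 (m : Fin 3) (I : Fin 1 → Fin 3) : Continuous fun p => dS (Y1 m) p I :=
  (isCn_dS (m := 0) (isCn_Y1 (n := 1) m) (by norm_num) I).continuous

theorem continuous_E1 (m : Fin 3) (I : Fin 1 → Fin 3) : Continuous fun p => E1 m p I :=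
  continuous_const.mul (continuous_dS_Y1 m I).neg

theorem continuous_areaForm (a b : Fin 3) : Continuous fun p => areaForm p a b := by
  refine (isCn_det (n := 0) fun i j => ?_).continuous
  fin_cases i
  · exact isCn_coord j
  · exact isCn_const _
  · exact isCn_const _

theorem continuous_H1 (m : Fin 3) (I : Fin 1 → Fin 3) : Continuous fun p => H1 m p I :=
  continuous_const.mul (continuous_finsetSum _ fun b _ =>
    (continuous_areaForm _ b).mul (continuous_dS_Y1 m _))

/-- Functions with the same modes `l ≥ 2` agree if their difference is orthogonal to the modes
`l ≤ 1` with respect to a positive weight. -/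
theorem eq_of_high_eq {f f' w : S2 → ℝ} (hw : Continuous w)
    (hpos : ∀ p, 0 < w p) (hh : high f = high f')
    (h0 : ∫ p, w p * (f p - f' p) * Y0 p ∂area = 0)
    (h1 : ∀ m, ∫ p, w p * (f p - f' p) * Y1 m p ∂area = 0) : f = f' := by
  -- `none` stands for degree 0 and `some m` for degree 1.
  let Z : Option (Fin 3) → S2 → Unit → ℝ := fun i p _ => i.elim (Y0 p) fun m => Y1 m p
  let c : Option (Fin 3) → ℝ := fun i =>
    i.elim (coeff f Y0 - coeff f' Y0) fun m => coeff f (Y1 m) - coeff f' (Y1 m)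
  -- Equal parts `l ≥ 2` make `f - f'` the difference of the low parts, a combination of the four
  -- harmonics.
  have hδ : ∀ p, ∑ j, c j * Z j p () = f p - f' p := by
    intro p
    have h := congrFun hh p
    simp only [high, low, Pi.sub_apply, Pi.add_apply, Pi.smul_apply, smul_eq_mul,
      Finset.sum_apply] at h
    rw [Fintype.sum_option]
    simp only [c, Z, Option.elim, sub_mul, Finset.sum_sub_distrib]
    linarith
  have hZ : ∀ i a, Continuous fun p => Z i p a := by
    rintro (_ | m) a
    · exact continuous_const
    · exact continuous_Y1 m
  funext p
  have key := sum_mul_eq_zero_of_integral hZ hw hpos c (fun i => ?_) p ()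
  · rw [hδ] at key
    linarith
  · simp only [Finset.univ_unique, Finset.sum_singleton, PUnit.default_eq_unit, hδ]
    rcases i with _ | m
    · simpa only [Z, Option.elim, mul_assoc] using h0
    · simpa only [Z, Option.elim, mul_assoc] using h1 m

theorem vec_eq (I : Fin 1 → Fin 3) : I = ![I 0] := by
  funext i
  rw [Subsingleton.elim i 0]
  rfl

/-- 1-forms with the same modes `l ≥ 2` agree if their difference is orthogonal to the modes
`l = 1` with respect to a positive weight. -/
theorem eq_of_vhigh_eq {X X' : TensorField 1} {w : S2 → ℝ} (hw : Continuous w)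
    (hpos : ∀ p, 0 < w p) (hh : vhigh X = vhigh X')
    (hE : ∀ m, ∫ p, w p * ∑ a, (X p ![a] - X' p ![a]) * E1 m p ![a] ∂area = 0)
    (hH : ∀ m, ∫ p, w p * ∑ a, (X p ![a] - X' p ![a]) * H1 m p ![a] ∂area = 0) : X = X' := by
  let Z : Fin 3 ⊕ Fin 3 → S2 → Fin 3 → ℝ := fun i p a =>
    i.elim (fun m => E1 m p ![a]) fun m => H1 m p ![a]
  let c : Fin 3 ⊕ Fin 3 → ℝ := fun i =>
    i.elim (fun m => vcoeff X (E1 m) - vcoeff X' (E1 m))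
      fun m => vcoeff X (H1 m) - vcoeff X' (H1 m)
  have hδ : ∀ p a, ∑ j, c j * Z j p a = X p ![a] - X' p ![a] := by
    intro p a
    have h := congrFun (congrFun hh p) ![a]
    simp only [vhigh, vlow, Pi.sub_apply, Pi.add_apply, Pi.smul_apply, smul_eq_mul,
      Finset.sum_apply, Finset.sum_add_distrib] at h
    rw [Fintype.sum_sum_type]
    simp only [c, Z, Sum.elim_inl, Sum.elim_inr, sub_mul, Finset.sum_sub_distrib]
    linarith
  have hZ : ∀ i a, Continuous fun p => Z i p a := by
    rintro (m | m) a
    · exact continuous_E1 m _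
    · exact continuous_H1 m _
  funext p I
  have key := sum_mul_eq_zero_of_integral hZ hw hpos c (fun i => ?_) p (I 0)
  · rw [hδ, ← vec_eq I] at key
    linarith
  · simp only [hδ]
    rcases i with m | m
    · exact hE m
    · exact hH m

/-- The gradient terms depend only on shared quantities and cancel, leaving an expression linear in
the difference of `η`. -/
theorem chargeForm_sub {x x' : SphereTuple} (hΩ : x.Ω = x'.Ω) (hg : x.g = x'.g)
    (ht : x.Ωtrχ = x'.Ωtrχ) (p : S2) (I : Fin 1 → Fin 3) :
    chargeForm x p I - chargeForm x' p I
      = areaRadius x.g ^ 3 * (trχ x p * (x.η p I - x'.η p I)) := by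
  have h : trχ x = trχ x' := by
    unfold trχ
    rw [hΩ, ht]
  unfold chargeForm
  rw [← h, ← hg, ← hΩ]
  ring

/-- Once `η` is shared, so are `ζ` and `β`; the only difference left is the term `¼ trχ trχbar` in
`ρ`. -/
theorem chargeScalar_sub {x x' : SphereTuple} (hΩ : x.Ω = x'.Ω) (hg : x.g = x'.g)
    (ht : x.Ωtrχ = x'.Ωtrχ) (hχ : x.χhat = x'.χhat) (hχbar : x.χhatbar = x'.χhatbar)
    (hη : x.η = x'.η) (p : S2) :
    chargeScalar x p - chargeScalar x' p
      = -(1 / 4) * areaRadius x.g ^ 3 * (trχ x p / x.Ω p * (x.Ωtrχbar p - x'.Ωtrχbar p)) := by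
  have h : trχ x = trχ x' := by
    unfold trχ
    rw [hΩ, ht]
  have hζ : ζ x = ζ x' := by
    unfold ζ
    rw [hΩ, hη]
  have hβ : β x = β x' := by
    unfold β
    rw [h, hζ, hg, hχ]
  unfold chargeScalar ρ trχbar
  rw [← h, ← hβ, ← hg, ← hχ, ← hχbar, ← hΩ]
  ring

/-- Data with equal matching data and charges agree if `tr χ` is positive. -/
theorem eq_of_matching_of_charges {u v : ℝ} {x x' : SphereTuple} (hx : IsRegularData x)
    (hx' : IsRegularData x') (hpos : ∀ p, 0 < x.Ωtrχ p) (hM : matching u v x = matching u v x')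
    (hC : charges x = charges x') : x = x' := by
  have hΩ : x.Ω = x'.Ω := congrArg MatchingData.Ω hM
  have hφ : confFactor x.g = confFactor x'.g := congrArg MatchingData.φ hM
  have hgc : confMetric x.g = confMetric x'.g := congrArg MatchingData.gc hM
  have ht : x.Ωtrχ = x'.Ωtrχ := congrArg MatchingData.Ωtrχ hM
  have hχ : x.χhat = x'.χhat := congrArg MatchingData.χhat hM
  have htb : high x.Ωtrχbar = high x'.Ωtrχbar := congrArg MatchingData.Ωtrχbar_high hM
  have hχb : x.χhatbar = x'.χhatbar := congrArg MatchingData.χhatbar hM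
  have hηh : vhigh x.η = vhigh x'.η := congrArg MatchingData.η_high hM
  have hωh : high x.ωbar = high x'.ωbar := congrArg MatchingData.ωbar_high hM
  have hDh : high x.DbarOmegaBar = high x'.DbarOmegaBar :=
    congrArg MatchingData.DbarOmegaBar_high hM
  have h5 : Q5 u v x = Q5 u v x' := congrArg MatchingData.Q5 hM
  have h6 : Q6 u v x = Q6 u v x' := congrArg MatchingData.Q6 hM
  have hg : x.g = x'.g := by
    funext p I
    have h1 : (confFactor x.g p ^ 2)⁻¹ * x.g p I = (confFactor x'.g p ^ 2)⁻¹ * x'.g p I :=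
      congrFun (congrFun hgc p) I
    rw [← hφ] at h1
    exact mul_left_cancel₀ (inv_ne_zero (pow_ne_zero 2 (hx.g_metric.confFactor_pos p).ne')) h1
  have hr : areaRadius x.g ^ 3 ≠ 0 := pow_ne_zero 3 hx.g_metric.areaRadius_pos.ne'
  have hπ := Real.pi_pos
  have htr : ∀ p, 0 < trχ x p := fun p => div_pos (hpos p) (hx.Ω_pos p)
  have htc := hx.isCn_trχ.continuous
  -- Equal coefficients of the charge forms become weighted orthogonality of `η - η'`. The integrals
  -- can be subtracted because the integrands are continuous.
  have form : ∀ Z : TensorField 1, (∀ I, Continuous fun p => Z p I) →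
      vcoeff (chargeForm x) Z = vcoeff (chargeForm x') Z →
      ∫ p, trχ x p * ∑ a, (x.η p ![a] - x'.η p ![a]) * Z p ![a] ∂area = 0 := by
    intro Z hZ h
    have i1 := integrable_of_continuous (f := fun p => ∑ a, chargeForm x p ![a] * Z p ![a])
      (continuous_finsetSum _ fun a _ => (hx.continuous_chargeForm _).mul (hZ _))
    have i2 := integrable_of_continuous (f := fun p => ∑ a, chargeForm x' p ![a] * Z p ![a])
      (continuous_finsetSum _ fun a _ => (hx'.continuous_chargeForm _).mul (hZ _))
    rw [vcoeff, vcoeff, ← sub_eq_zero, ← integral_sub i1 i2] at h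
    have e : ∀ p, ∑ a, chargeForm x p ![a] * Z p ![a] - ∑ a, chargeForm x' p ![a] * Z p ![a]
        = areaRadius x.g ^ 3 * (trχ x p * ∑ a, (x.η p ![a] - x'.η p ![a]) * Z p ![a]) := by
      intro p
      rw [← Finset.sum_sub_distrib, Finset.mul_sum, Finset.mul_sum]
      refine Finset.sum_congr rfl fun a _ => ?_
      rw [← sub_mul, chargeForm_sub hΩ hg ht]
      ring
    simp only [e] at h
    rw [integral_const_mul] at h
    exact (mul_eq_zero.1 h).resolve_left hr
  -- `η` has to come before `Ωtrχbar`, since `β` in the charges `E` and `P` involves `η`.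
  have hη : x.η = x'.η := by
    refine eq_of_vhigh_eq htc htr hηh (fun m => form _ (continuous_E1 m) ?_)
      (fun m => form _ (continuous_H1 m) ?_)
    · exact mul_left_cancel₀ (by positivity) (congrFun (congrArg Charges.G hC) m)
    · exact mul_left_cancel₀ (by positivity) (congrFun (congrArg Charges.L hC) m)
  have scal : ∀ Y : S2 → ℝ, Continuous Y →
      coeff (chargeScalar x) Y = coeff (chargeScalar x') Y →
      ∫ p, trχ x p / x.Ω p * (x.Ωtrχbar p - x'.Ωtrχbar p) * Y p ∂area = 0 := by
    intro Y hY h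
    have i1 := integrable_of_continuous (f := fun p => chargeScalar x p * Y p)
      (hx.continuous_chargeScalar.mul hY)
    have i2 := integrable_of_continuous (f := fun p => chargeScalar x' p * Y p)
      (hx'.continuous_chargeScalar.mul hY)
    rw [coeff, coeff, ← sub_eq_zero, ← integral_sub i1 i2] at h
    simp only [← sub_mul, chargeScalar_sub hΩ hg ht hχ hχb hη, mul_assoc] at h
    rw [integral_const_mul, integral_const_mul] at h
    have h' := (mul_eq_zero.1 ((mul_eq_zero.1 h).resolve_left (by norm_num))).resolve_left hr
    simpa only [mul_assoc] using h'
  have hb : x.Ωtrχbar = x'.Ωtrχbar := by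
    refine eq_of_high_eq (htc.div hx.Ω_cont fun p => (hx.Ω_pos p).ne')
      (fun p => div_pos (htr p) (hx.Ω_pos p)) htb (scal _ continuous_const ?_)
      (fun m => scal _ (continuous_Y1 m) ?_)
    · exact mul_left_cancel₀ (mul_ne_zero (neg_ne_zero.2 (by positivity)) (by positivity))
        (congrArg Charges.E hC)
    · exact mul_left_cancel₀ (mul_ne_zero (neg_ne_zero.2 (by positivity)) (by positivity))
        (congrFun (congrArg Charges.P hC) m)
  -- Every other term of `Q5` is built from quantities already identified, and likewise for `Q6`
  -- below.
  have hω : x.ωbar = x'.ωbar := by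
    have h : low x.ωbar = low x'.ωbar := by
      simpa only [Q5, hΩ, hg, ht, hη, hb, sub_left_inj, add_left_inj] using h5
    rw [high, high, h] at hωh
    exact sub_left_inj.1 hωh
  have hD : x.DbarOmegaBar = x'.DbarOmegaBar := by
    have h : low x.DbarOmegaBar = low x'.DbarOmegaBar := by
      simpa only [Q6, hΩ, hg, ht, hη, hb, sub_left_inj, add_left_inj] using h6
    rw [high, high, h] at hDh
    exact sub_left_inj.1 hDh
  exact SphereTuple.ext hΩ hg ht hχ hb hχb hη (congrArg MatchingData.ω hM)
    (congrArg MatchingData.Dω hM) hω hD (congrArg MatchingData.α hM)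
    (congrArg MatchingData.αbar hM)

/-! ### Positivity of the outgoing expansion near Minkowski, and the conclusion. -/

theorem sobolevNorm_Ωtrχ_le_normX (u v : ℝ) (x : SphereTuple) :
    sobolevNorm (v - u) 6 (scalar x.Ωtrχ) ≤ normX u v x := by
  unfold normX
  -- Ten summands follow that of `Ωtrχ` in the left-nested sum.
  iterate 10 refine le_trans ?_ le_self_add
  exact le_add_self

/-- Close to the Minkowski data the outgoing null expansion is positive. -/
theorem exists_forall_Ωtrχ_pos {u v : ℝ} (huv : u < v) : ∃ ε₀ : ℝ, 0 < ε₀ ∧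
    ∀ x, IsSphereData x → normX u v (x - minkowski u v) ≤ ENNReal.ofReal ε₀ →
      ∀ p, 0 < x.Ωtrχ p := by
  have hr : 0 < v - u := sub_pos.2 huv
  obtain ⟨C, hC, h⟩ := exists_enorm_sq_le_sobolevNorm hr (m := 6) (by norm_num) 0
  set c := C.toReal with hc
  have hc0 : 0 ≤ c := ENNReal.toReal_nonneg
  -- Chosen so that `c (2 ε₀)² ≤ (1 / (v - u))²`; then `Ωtrχ` stays within `1 / (v - u)` of `2 / (v
  -- - u)`. The doubling of `ε₀` serves the strict inequality in the pointwise bound.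
  set ε₀ := 1 / (2 * (v - u) * (c + 1)) with hε
  have hε0 : 0 < ε₀ := by positivity
  refine ⟨ε₀, hε0, fun x hx hn p => ?_⟩
  have h1 := h (scalar (x - minkowski u v).Ωtrχ) (ENNReal.ofReal (2 * ε₀))
    (continuous_pi fun _ => hx.Ωtrχ_cont.sub continuous_const)
    (((sobolevNorm_Ωtrχ_le_normX u v _).trans hn).trans_lt
      ((ENNReal.ofReal_lt_ofReal_iff (by positivity)).2 (by linarith))) p ![]
  have e : scalar (x - minkowski u v).Ωtrχ p ![] = x.Ωtrχ p - 2 / (v - u) := rfl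
  rw [e, ← ENNReal.ofReal_toReal hC, ← hc, Real.enorm_eq_ofReal_abs,
    ← ENNReal.ofReal_pow (abs_nonneg _), ← ENNReal.ofReal_pow (by positivity),
    ← ENNReal.ofReal_mul hc0, ENNReal.ofReal_le_ofReal_iff (by positivity), sq_abs] at h1
  have h2 : c * (2 * ε₀) ^ 2 ≤ (1 / (v - u)) ^ 2 := by
    have e2 : c * (2 * ε₀) ^ 2 = (1 / (v - u)) ^ 2 * (c / (c + 1) ^ 2) := by
      rw [hε]
      field_simp
    rw [e2]
    refine mul_le_of_le_one_right (by positivity) ?_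
    rw [div_le_one (by positivity)]
    nlinarith
  have h3 := abs_le_of_sq_le_sq' (h1.trans h2) (by positivity)
  have h4 : 0 < 1 / (v - u) := by positivity
  have h5 : 2 / (v - u) = 2 * (1 / (v - u)) := by ring
  linarith [h3.1]

end CharGluing

end

/-- Smallness enters only through the positivity of `Ωtrχ` for `x`; for regularity, finite norms
suffice. -/
theorem lemma2p6 (u v : ℝ) (huv : u < v) :
    ∃ ε₀ : ℝ, 0 < ε₀ ∧ ∀ ε : ℝ, 0 < ε → ε ≤ ε₀ →
      ∀ x x' : CharGluing.SphereTuple,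
        CharGluing.IsSphereData x → CharGluing.IsSphereData x' →
        CharGluing.normX u v (x - CharGluing.minkowski u v)
            + CharGluing.normX u v (x' - CharGluing.minkowski u v) ≤ ENNReal.ofReal ε →
        CharGluing.matching u v x = CharGluing.matching u v x' →
        CharGluing.charges x = CharGluing.charges x' →
        x = x' := by
  obtain ⟨ε₀, h0, h⟩ := CharGluing.exists_forall_Ωtrχ_pos huv
  refine ⟨ε₀, h0, fun ε _ hε x x' hx hx' hn hM hC => ?_⟩
  have hx1 := le_self_add.trans hn
  have hx2 := le_add_self.trans hn
  exact CharGluing.eq_of_matching_of_charges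
    (hx.isRegularData (ne_top_of_le_ne_top ENNReal.ofReal_ne_top hx1))
    (hx'.isRegularData (ne_top_of_le_ne_top ENNReal.ofReal_ne_top hx2))
    (h x hx (hx1.trans (ENNReal.ofReal_le_ofReal hε))) hM hC
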